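/- Let $R$ be a commutative noetherian ring of finite Krull dimension. For a cochain complex $N$ put $\sup N=\sup\{n\in\mathbb Z: H^n(N)\ne0\}$ and $\inf N=\inf\{n\in\mathbb Z: H^n(N)\neq 0\}$ in $\mathbb Z\cup\{\pm\infty\}$ (with $\sup N=-\infty$ and $\inf N=+\infty$ if $N$ is acyclic); a complex is cohomologically bounded if its nonzero cohomology lies in finitely many degrees. For an ideal $I$ and a complex $M$ of $R$-modules let $\operatorname{depth}(I,M)=\inf \mathbf R\mathrm{Hom}_R(R/I,M)$ and $\operatorname{width}(I,M)=-\sup(R/I\otimes_R^{\mathbf L}M)$; over a local ring $(A,\mathfrak m)$ write $\operatorname{depth}_A$ and $\operatorname{width}_A$ for these invariants with $I=\mathfrak m$. Let $$\mathsf{Ch}_R(M)=\sup_{\mathfrak p\in\operatorname{Spec}R}\bigl(\operatorname{depth}R_{\mathfrak p}-\operatorname{width}_{R_{\mathfrak p}}(M_{\mathfrak p})\bigr),$$ $$\mathsf{rid}_R(M)=\sup\{i\in\mathbb Z:\operatorname{Ext}^i_R(T,M)\ne0\text{ for some finitely generated module }T\text{ of finite projective dimension}\},$$ $$\mathcal T_{\mathsf{height}}=\{M\in\operatorname{Mod}R:\operatorname{width}(\mathfrak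 p,M)\ge\operatorname{height}(\mathfrak p)\text{ for all }\mathfrak p\in\operatorname{Spec}R\},$$ where modules are regarded as complexes concentrated in degree $0$. (1) For every cohomologically bounded complex $M$ of $R$-modules, $$\sup_{\mathfrak p\in\operatorname{Spec}R}\bigl(\operatorname{height}(\mathfrak p)-\operatorname{width}_{R_{\mathfrak p}}(M_{\mathfrak p})\bigr)=\sup_{\mathfrak p\in\operatorname{Spec}R}\bigl(\operatorname{height}(\mathfrak p)-\operatorname{width}(\mathfrak p,M)\bigr).$$ (2) If in addition $R$ is Cohen–Macaulay (that is, $\operatorname{depth}R_{\mathfrak p}=\dim R_{\mathfrak p}$ for all $\mathfrak p\in\operatorname{Spec}R$), then $\mathsf{Ch}_R(M)=\mathsf{rid}_R(M)$ for every cohomologically bounded complex $M$ of $R$-modules. (3) If $R$ is Cohen–Macaulay, then $\mathcal T_{\mathsf{height}}=\{M\in\operatorname{Mod}R:\mathsf{Ch}_R(M)\le0\}$. -/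

import Mathlib

open CategoryTheory

universe u

noncomputable section

namespace RestrictedInjDim

/-- Complexes of `R`-modules, with cohomological (upper) grading by `ℤ`. -/
abbrev Cpx (R : Type u) [CommRing R] := CochainComplex (ModuleCat.{u} R) ℤ

section CohomologicalBounds

variable {C : Type*} [Category C] [Abelian C]

/-- `sup K = sup {n | Hⁿ(K) ≠ 0}` in the extended line; it is `-∞` if `K` is acyclic. -/
def cohSup (K : CochainComplex C ℤ) : EReal :=
  ⨆ n ∈ {n : ℤ | ¬ Limits.IsZero (K.homology n)}, ((n : ℝ) : EReal)

/-- `inf K = inf {n | Hⁿ(K) ≠ 0}` in the extended line; it is `+∞` if `K` is acyclic. -/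
def cohInf (K : CochainComplex C ℤ) : EReal :=
  ⨅ n ∈ {n : ℤ | ¬ Limits.IsZero (K.homology n)}, ((n : ℝ) : EReal)

/-- `K` is cohomologically bounded: all nonzero cohomology lies in a finite range of degrees
(this includes the acyclic complexes). -/
def IsCohBounded (K : CochainComplex C ℤ) : Prop :=
  ∃ a b : ℤ, ∀ n : ℤ, ¬ Limits.IsZero (K.homology n) → a ≤ n ∧ n ≤ b

end CohomologicalBounds

section DerivedFunctors

variable {R : Type u} [CommRing R]

/-- A module, seen as a complex concentrated in degree `0`. -/
abbrev single (N : ModuleCat.{u} R) : Cpx R := (CochainComplex.singleFunctor (ModuleCat.{u} R) 0).obj N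

/-- A projective resolution `P` of the module `N`, as a cochain complex in degrees `≤ 0`. -/
def projRes (N : ModuleCat.{u} R) : Cpx R := (projectiveResolution N).cochainComplex

/-- `N ⊗ᴸ M` for a module `N` and a complex `M`: the total tensor product (with direct sums)
`P ⊗ M`, where `P` is a projective resolution of `N`. Thus `Tor_i(N, M) = H⁻ⁱ(N ⊗ᴸ M)`. -/
def derivedTensor (N : ModuleCat.{u} R) (M : Cpx R) : Cpx R :=
  HomologicalComplex.tensorObj (projRes N) M

/-- `RHom(N, M)` for a module `N` and a complex `M`: the total Hom complex `Hom(P, M)`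
(with direct products), where `P` is a projective resolution of `N`.
Thus `Ext^i(N, M) = Hⁱ(RHom(N, M))`. -/
def derivedHom (N : ModuleCat.{u} R) (M : Cpx R) : CochainComplex AddCommGrpCat.{u} ℤ :=
  CochainComplex.HomComplex (projRes N) M

/-- `depth(I, M) = inf RHom(R/I, M)`. -/
def depth (I : Ideal R) (M : Cpx R) : EReal :=
  cohInf (derivedHom (ModuleCat.of R (R ⧸ I)) M)

/-- `width(I, M) = - sup (R/I ⊗ᴸ M)`. -/
def width (I : Ideal R) (M : Cpx R) : EReal :=
  - cohSup (derivedTensor (ModuleCat.of R (R ⧸ I)) M)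

end DerivedFunctors

section Local

variable (A : Type u) [CommRing A] [IsLocalRing A]

/-- The depth of a complex over a local ring, with respect to the maximal ideal. -/
def localDepth (M : Cpx A) : EReal := depth (IsLocalRing.maximalIdeal A) M

/-- The width of a complex over a local ring, with respect to the maximal ideal. -/
def localWidth (M : Cpx A) : EReal := width (IsLocalRing.maximalIdeal A) M

/-- The depth of the local ring `A`. -/
def ringDepth : EReal := localDepth A (single (ModuleCat.of A A))

end Local

section Global

variable {R : Type u} [CommRing R]

/-- The height of a prime ideal, i.e. the Krull dimension of the local ring at it. -/
def height (p : PrimeSpectrum R) : EReal := ((p.asIdeal.height : ENNReal) : EReal)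

/-- The localization `M_p` of a complex `M` at a prime `p`, as a complex over `R_p`. -/
def localize (p : PrimeSpectrum R) (M : Cpx R) : Cpx (Localization.AtPrime p.asIdeal) :=
  ((ModuleCat.localizedModuleFunctor.{u} p.asIdeal.primeCompl).mapHomologicalComplex
    (ComplexShape.up ℤ)).obj M

variable (R) in
/-- All local rings `R_p` satisfy `depth R_p = dim R_p`; for noetherian `R` this says that `R` is
a Cohen–Macaulay ring. -/
def IsCohenMacaulay : Prop :=
  ∀ p : PrimeSpectrum R, ringDepth (Localization.AtPrime p.asIdeal) = height p

/-- The Chouinard invariant `Ch_R(M) = sup_p (depth R_p - width_{R_p}(M_p))`. -/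
def chouinard (M : Cpx R) : EReal :=
  ⨆ p : PrimeSpectrum R, ringDepth (Localization.AtPrime p.asIdeal) -
    localWidth (Localization.AtPrime p.asIdeal) (localize p M)

/-- The class of finitely generated modules of finite projective dimension. (Over a noetherian
ring, the finitely generated modules are exactly those admitting a resolution by
finitely generated projective modules.) -/
def FinProj (T : ModuleCat.{u} R) : Prop :=
  Module.Finite R T ∧ ∃ n : ℕ, HasProjectiveDimensionLE T n

/-- The small restricted injective dimension
`rid_R(M) = sup {i | Ext^i(T, M) ≠ 0 for some T finitely generated of finite proj. dimension}`. -/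
def rid (M : Cpx R) : EReal :=
  ⨆ i ∈ {i : ℤ | ∃ T : ModuleCat.{u} R, FinProj T ∧ ¬ Limits.IsZero ((derivedHom T M).homology i)},
    ((i : ℝ) : EReal)

/-- The class `T_f` of modules attached to a function `f` on the spectrum:
all modules `M` with `width(p, M) ≥ f p` for every prime `p`. -/
def widthClass (f : PrimeSpectrum R → EReal) : Set (ModuleCat.{u} R) :=
  {M | ∀ p : PrimeSpectrum R, f p ≤ width p.asIdeal (single M)}

end Global

end RestrictedInjDim

end

/-! Vanishing of H^n(N ⊗ᴸ M) is traded for vanishing of Hom_D(N, M^∨[-n]), where M^∨ is the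
character dual, which detects zero (`isZero_derivedTensor_homology_iff`). All arguments about Tor
thereby become arguments about triangles and morphisms in the derived category. Local against global
width: H(k(p) ⊗ᴸ M_p) is the localization at p of H(R/p ⊗ᴸ M), so each local term is at most the
global one. Conversely, let H^n(R/p ⊗ᴸ M) be nonzero with zero localization at p. Some nonzero class
is killed by an s outside p, and 0 → R/p → R/p → R/(p + sR) → 0 with a prime filtration of the last
term yields q > p with H^(n-1)(R/q ⊗ᴸ M) ≠ 0. The height rises by at least 1 as the degree drops by
1, so noetherian induction ends at a prime where the localization survives. Over a Cohen–Macaulay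
ring depth R_p is the height of p, so `chouinard` equals S, the supremum of height(p) - width(p, M),
and only rid = S remains. Both inequalities rest on F^* ⊗ M ≅ Hom(F, M) for a bounded complex F of
finitely generated projectives. S ≤ rid (`IsCohenMacaulay.iSup_height_sub_width_le_rid`): if p has
height d, it contains a weakly regular sequence of length d generating an ideal I. The dual of a
resolution of R/I has cohomology only in degree d, namely T = Ext^d(R/I, R), which has finite
projective dimension, and Ext^(j+d)(T, M) is H^j(R/I ⊗ᴸ M). Boundedness of M passes nonvanishing
from R/p to R/I in some degree j ≥ n. rid ≤ S (`rid_le_iSup_height_sub_width`): if F resolves T,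
then H^l(F^*) = Ext^l(T, R) is supported at primes of height ≥ l, because finite projective
dimensions over a noetherian local ring are at most its dimension. Dévissage of F^* turns Ext^i(T,
M) ≠ 0 into H^(i-l)(R/q ⊗ᴸ M) ≠ 0 with height(q) ≥ l. The description of the height class is then S
≤ 0 read prime by prime. -/

noncomputable section

namespace RestrictedInjDim

open Limits CochainComplex HomComplex DerivedCategory

attribute [local instance] HasDerivedCategory.standard

/-! ### Morphisms in the derived category out of a K-projective complex, as cocycles modulo
coboundaries. -/

section Bridge

variable {C : Type*} [Category C] [Abelian C]

/-- The morphism in the derived category defined by a cocycle of a Hom complex. -/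
def derivedClass {K X : CochainComplex C ℤ} {n : ℤ} (z : Cocycle K X n) :
    Q.obj K ⟶ (Q.obj X)⟦n⟧ :=
  Q.map (Cocycle.equivHomShift.symm z) ≫ (Q.commShiftIso n).hom.app X

lemma derivedClass_smul {R : Type*} [Ring R] [Linear R C] {K X : CochainComplex C ℤ} {n : ℤ}
    (r : R) (z : Cocycle K X n) : derivedClass (r • z) = r • derivedClass z := by
  have h : Cocycle.equivHomShift.symm (r • z) = r • Cocycle.equivHomShift.symm z := by
    ext p
    simp [Cocycle.equivHomShift_symm_apply, Cocycle.rightShift, Cochain.rightShift_v _ _ _ _ _ _ _ _ rfl]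
  rw [derivedClass, h, Functor.map_smul, Linear.smul_comp, derivedClass]

lemma derivedClass_add {K X : CochainComplex C ℤ} {n : ℤ} (z z' : Cocycle K X n) :
    derivedClass (z + z') = derivedClass z + derivedClass z' := by
  simp [derivedClass]

lemma derivedClass_eq_Qh_map {K X : CochainComplex C ℤ} {n : ℤ} (z : Cocycle K X n) :
    derivedClass z = (quotientCompQhIso C).inv.app K ≫
      Qh.map (CohomologyClass.toHom (CohomologyClass.mk z)) ≫
      (quotientCompQhIso C).hom.app (X⟦n⟧) ≫ (Q.commShiftIso n).hom.app X := by
  rw [CohomologyClass.toHom_mk, quotientCompQhIso_hom_naturality_assoc]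
  simp [derivedClass]

/-- K-projectivity makes homotopy classes of maps out of K agree with derived morphisms, and
null-homotopic cocycles are the coboundaries. -/
lemma derivedClass_eq_zero_iff {K X : CochainComplex C ℤ} [K.IsKProjective] {n : ℤ}
    (z : Cocycle K X n) :
    derivedClass z = 0 ↔ ∃ w : Cochain K X (n - 1), δ (n - 1) n w = z := by
  rw [← mem_coboundaries_iff _ (n - 1) (by simp), ← CohomologyClass.toHom_mk_eq_zero_iff,
    derivedClass_eq_Qh_map, Preadditive.IsIso.comp_left_eq_zero,
    Preadditive.IsIso.comp_right_eq_zero]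
  exact ⟨fun h ↦ (IsKProjective.Qh_map_bijective K _).1 (by rw [h, Functor.map_zero]),
    fun h ↦ by rw [h, Functor.map_zero]⟩

lemma derivedClass_surjective {K X : CochainComplex C ℤ} [K.IsKProjective] {n : ℤ} :
    Function.Surjective (derivedClass : Cocycle K X n → _) := by
  intro f
  let e := (quotientCompQhIso C).app (X⟦n⟧) ≪≫ (Q.commShiftIso n).app X
  obtain ⟨g, hg⟩ := (IsKProjective.Qh_map_bijective K _).2
    ((quotientCompQhIso C).hom.app K ≫ f ≫ e.inv)
  obtain ⟨x, rfl⟩ := (CohomologyClass.toHom_bijective K X n).2 g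
  obtain ⟨z, rfl⟩ := x.mk_surjective
  refine ⟨z, ?_⟩
  rw [derivedClass_eq_Qh_map, hg]
  simp [e]

/-- All morphisms `A ⟶ Y⟦n⟧` vanish. -/
def ExtVanish (A Y : DerivedCategory C) (n : ℤ) : Prop := ∀ f : A ⟶ Y⟦n⟧, f = 0

lemma extVanish_Q_iff {K X : CochainComplex C ℤ} [K.IsKProjective] {n : ℤ} :
    ExtVanish (Q.obj K) (Q.obj X) n ↔
      ∀ z : Cocycle K X n, ∃ w : Cochain K X (n - 1), δ (n - 1) n w = z := by
  refine ⟨fun h z ↦ (derivedClass_eq_zero_iff z).1 (h _), fun h f ↦ ?_⟩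
  obtain ⟨z, rfl⟩ := derivedClass_surjective f
  exact (derivedClass_eq_zero_iff z).2 (h z)

lemma isZero_homComplex_homology_iff {K X : CochainComplex C ℤ} [K.IsKProjective] {n : ℤ} :
    IsZero ((HomComplex K X).homology n) ↔ ExtVanish (Q.obj K) (Q.obj X) n := by
  refine AddCommGrpCat.isZero_iff_subsingleton.trans <|
    (homologyAddEquiv K X n).toEquiv.subsingleton_congr.trans <|
    Iff.trans ?_ extVanish_Q_iff.symm
  refine ⟨fun h z ↦ ?_, fun h ↦ ⟨fun x y ↦ ?_⟩⟩
  · have hz : CohomologyClass.mk z = 0 := h.elim _ _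
    exact (mem_coboundaries_iff z (n - 1) (by simp)).1 ((CohomologyClass.mk_eq_zero_iff z).1 hz)
  · have h' (x : CohomologyClass K X n) : x = 0 := by
      obtain ⟨z, rfl⟩ := x.mk_surjective
      exact (CohomologyClass.mk_eq_zero_iff z).2
        ((mem_coboundaries_iff z (n - 1) (by simp)).2 (h z))
    rw [h' x, h' y]

end Bridge

/-! ### Vanishing of morphisms along shifts and distinguished triangles. -/

section LongExact

variable {C : Type*} [Category C] [Abelian C]

lemma ExtVanish.congr_left {A B Y : DerivedCategory C} {n : ℤ} (h : ExtVanish A Y n)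
    (e : A ≅ B) : ExtVanish B Y n := fun f ↦ by
  rw [← cancel_epi e.hom, h (e.hom ≫ f), comp_zero]

lemma extVanish_congr_left {A B Y : DerivedCategory C} {n : ℤ} (e : A ≅ B) :
    ExtVanish A Y n ↔ ExtVanish B Y n :=
  ⟨fun h ↦ h.congr_left e, fun h ↦ h.congr_left e.symm⟩

lemma extVanish_congr_right {A Y Z : DerivedCategory C} {n : ℤ} (e : Y ≅ Z) :
    ExtVanish A Y n ↔ ExtVanish A Z n := by
  let e' := (CategoryTheory.shiftFunctor (DerivedCategory C) n).mapIso e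
  refine ⟨fun h f ↦ ?_, fun h f ↦ ?_⟩
  · rw [← cancel_mono e'.inv, h (f ≫ e'.inv), zero_comp]
  · rw [← cancel_mono e'.hom, h (f ≫ e'.hom), zero_comp]

lemma extVanish_shift_left_iff {A Y : DerivedCategory C} {m n k : ℤ} (hk : m + k = n) :
    ExtVanish (A⟦k⟧) Y n ↔ ExtVanish A Y m := by
  let e : (Y⟦m⟧)⟦k⟧ ≅ Y⟦n⟧ := ((CategoryTheory.shiftFunctorAdd' (DerivedCategory C) m k n hk).app Y).symm
  refine ⟨fun h f ↦ ?_, fun h f ↦ ?_⟩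
  · apply (CategoryTheory.shiftFunctor (DerivedCategory C) k).map_injective
    rw [Functor.map_zero, ← cancel_mono e.hom, zero_comp]
    exact h _
  · obtain ⟨g, hg⟩ := (CategoryTheory.shiftFunctor (DerivedCategory C) k).map_surjective (f ≫ e.inv)
    rw [← cancel_mono e.inv, ← hg, h g, Functor.map_zero, zero_comp]

open Pretriangulated

section Triangles

variable {T : Triangle (DerivedCategory C)} {Y : DerivedCategory C} {n : ℤ}

lemma ExtVanish.obj₂ (h₁ : ExtVanish T.obj₁ Y n) (h₃ : ExtVanish T.obj₃ Y n)
    (hT : T ∈ distTriang (DerivedCategory C)) : ExtVanish T.obj₂ Y n := fun f ↦ by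
  obtain ⟨g, rfl⟩ := T.yoneda_exact₂ hT f (h₁ _)
  rw [h₃ g, comp_zero]

/-- If `Hom(T.obj₂, Y⟦n⟧) = 0`, then every `T.obj₃ ⟶ Y⟦n⟧` is in the image of the
connecting map. -/
lemma ExtVanish.exists_eq_mor₃_comp (h₂ : ExtVanish T.obj₂ Y n)
    (hT : T ∈ distTriang (DerivedCategory C)) (f : T.obj₃ ⟶ Y⟦n⟧) :
    ∃ g : T.obj₁⟦(1 : ℤ)⟧ ⟶ Y⟦n⟧, f = T.mor₃ ≫ g :=
  T.yoneda_exact₃ hT f (h₂ _)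

lemma ExtVanish.obj₃ (h₁ : ExtVanish T.obj₁ Y n) (h₂ : ExtVanish T.obj₂ Y (n + 1))
    (hT : T ∈ distTriang (DerivedCategory C)) : ExtVanish T.obj₃ Y (n + 1) := fun f ↦ by
  obtain ⟨g, rfl⟩ := h₂.exists_eq_mor₃_comp hT f
  rw [(extVanish_shift_left_iff rfl).2 h₁ g, comp_zero]

lemma ExtVanish.exists_eq_mor₁_comp (h₃ : ExtVanish T.obj₃ Y (n + 1))
    (hT : T ∈ distTriang (DerivedCategory C)) (f : T.obj₁ ⟶ Y⟦n⟧) :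
    ∃ g : T.obj₂ ⟶ Y⟦n⟧, f = T.mor₁ ≫ g := by
  refine T.invRotate.yoneda_exact₂ (inv_rot_of_distTriang _ hT) f ?_
  have h : ExtVanish (T.obj₃⟦(-1 : ℤ)⟧) Y n :=
    (extVanish_shift_left_iff (by lia)).2 h₃
  exact h _

end Triangles

end LongExact

/-! ### Ext of a module computed by its projective resolution. -/

section Modules

variable {R : Type u} [CommRing R]

lemma isKProjective_projRes (N : ModuleCat.{u} R) : (projRes N).IsKProjective :=
  inferInstanceAs (projectiveResolution N).cochainComplex.IsKProjective

/-- A projective resolution is isomorphic to the module in the derived category. -/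
def projResIso (N : ModuleCat.{u} R) :
    Q.obj (projRes N) ≅ (DerivedCategory.singleFunctor (ModuleCat.{u} R) 0).obj N :=
  have : QuasiIso (projectiveResolution N).π' := inferInstance
  have : IsIso (Q.map (projectiveResolution N).π') :=
    Localization.inverts Q (HomologicalComplex.quasiIso _ (ComplexShape.up ℤ)) _ this
  @asIso _ _ _ _ _ this

/-- Vanishing of `Ext^n(N, Y)` for a module `N` and an object `Y` of the derived category. -/
abbrev ModExtVanish (N : ModuleCat.{u} R) (Y : DerivedCategory (ModuleCat.{u} R)) (n : ℤ) : Prop :=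
  ExtVanish ((DerivedCategory.singleFunctor (ModuleCat.{u} R) 0).obj N) Y n

lemma isZero_derivedHom_homology_iff (N : ModuleCat.{u} R) (M : Cpx R) (n : ℤ) :
    IsZero ((derivedHom N M).homology n) ↔ ModExtVanish N (Q.obj M) n :=
  have := isKProjective_projRes N
  isZero_homComplex_homology_iff.trans (extVanish_congr_left (projResIso N))

end Modules

open MonoidalCategory

/-! ### Tensor-Hom adjunction for dual complexes. -/

section Dual

variable {R : Type u} [CommRing R]

/-- The complex `Hom_R(M, E)`, with the sign convention for which cochains `K ⟶ Hom_R(M, E)`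
are linear forms `K ⊗ M ⟶ E`. -/
def dualComplex (E : ModuleCat.{u} R) (M : Cpx R) : Cpx R where
  X j := ModuleCat.of R (M.X (-j) →ₗ[R] E)
  d i j := ModuleCat.ofHom (j.negOnePow • LinearMap.lcomp R E (M.d (-j) (-i)).hom)
  shape i j h := by
    have : M.d (-j) (-i) = 0 := M.shape _ _ (fun h' ↦ h (by simp at h' ⊢; lia))
    rw [this]
    ext
    simp
  d_comp_d' i j k _ _ := by
    ext φ x
    have : M.d (-j) (-i) (M.d (-k) (-j) x) = 0 := by
      rw [← ConcreteCategory.comp_apply, M.d_comp_d]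
      rfl
    simp [Units.smul_def, this]

/-- An element of the dual complex, as a linear map. -/
def dualApply {E : ModuleCat.{u} R} {M : Cpx R} {j : ℤ} :
    (dualComplex E M).X j →ₗ[R] M.X (-j) →ₗ[R] E := LinearMap.id

lemma dualApply_d (E : ModuleCat.{u} R) (M : Cpx R) (i j : ℤ)
    (φ : (dualComplex E M).X i) (x : M.X (-j)) :
    dualApply ((dualComplex E M).d i j φ) x =
      j.negOnePow • dualApply φ (M.d (-j) (-i) x) := rfl

variable {E : ModuleCat.{u} R} {K M : Cpx R}

/-- The cochain `K ⟶ Hom_R(M, E)` corresponding to a linear form on `K ⊗ M`. -/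
def tensorFormCochain {n : ℤ} (m : ℤ) (h : n + m = 0)
    (Φ : (HomologicalComplex.tensorObj K M).X n ⟶ E) : Cochain K (dualComplex E M) m :=
  Cochain.mk fun p q hpq ↦ ModuleCat.ofHom
    (TensorProduct.curry (HomologicalComplex.ιTensorObj K M p (-q) n (by lia) ≫ Φ).hom)

lemma tensorFormCochain_v_apply {n : ℤ} (m : ℤ) (h : n + m = 0)
    (Φ : (HomologicalComplex.tensorObj K M).X n ⟶ E) (p q : ℤ) (hpq : p + m = q)
    (k : K.X p) (x : M.X (-q)) :
    dualApply ((tensorFormCochain m h Φ).v p q hpq k) x =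
      Φ (HomologicalComplex.ιTensorObj K M p (-q) n (by lia) (TensorProduct.tmul R k x)) := rfl

lemma tensorObj_d_ι_apply {p p' q q' n n' : ℤ} (h : p + q = n) (hp : p + 1 = p') (hq : q + 1 = q')
    (hn : n + 1 = n') (k : K.X p) (x : M.X q) :
    (HomologicalComplex.tensorObj K M).d n n'
      (HomologicalComplex.ιTensorObj K M p q n h (TensorProduct.tmul R k x)) =
    HomologicalComplex.ιTensorObj K M p' q n' (by lia) (TensorProduct.tmul R (K.d p p' k) x)
    + p.negOnePow • HomologicalComplex.ιTensorObj K M p q' n' (by lia)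
      (TensorProduct.tmul R k (M.d q q' x)) := by
  have : HomologicalComplex.ιTensorObj K M p q n h ≫ (HomologicalComplex.tensorObj K M).d n n' =
      (K.d p p' ▷ M.X q) ≫ HomologicalComplex.ιTensorObj K M p' q n' (by lia) +
      p.negOnePow • (K.X p ◁ M.d q q') ≫ HomologicalComplex.ιTensorObj K M p q' n' (by lia) := by
    rw [HomologicalComplex.mapBifunctor.d_eq, Preadditive.comp_add,
      HomologicalComplex.mapBifunctor.ι_D₁, HomologicalComplex.mapBifunctor.ι_D₂,
      HomologicalComplex.mapBifunctor.d₁_eq _ _ _ _ hp q n' (by simp; lia),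
      HomologicalComplex.mapBifunctor.d₂_eq _ _ _ _ p hq n' (by simp; lia)]
    simp
  exact congr($(this).hom (TensorProduct.tmul R k x))

/-- Up to a global sign the adjunction is compatible with the differentials; this is what the sign
in `dualComplex` is chosen for. -/
lemma δ_tensorFormCochain {n n' m m' : ℤ} (h : n + m = 0) (h' : n' + m' = 0) (hn : n' + 1 = n)
    (Φ : (HomologicalComplex.tensorObj K M).X n ⟶ E) :
    δ m m' (tensorFormCochain m h Φ) =
      m'.negOnePow • tensorFormCochain m' h' ((HomologicalComplex.tensorObj K M).d n' n ≫ Φ) := by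
  ext p q hpq k
  apply LinearMap.ext
  intro x
  rw [δ_v m m' (by lia) _ p q hpq (q - 1) (p + 1) rfl rfl]
  change dualApply ((dualComplex E M).d (q - 1) q ((tensorFormCochain m h Φ).v p (q - 1) _ k)) x +
    m'.negOnePow • dualApply ((tensorFormCochain m h Φ).v (p + 1) q _ (K.d p (p + 1) k)) x =
    m'.negOnePow • dualApply ((tensorFormCochain m' h' _).v p q hpq k) x
  rw [dualApply_d, tensorFormCochain_v_apply, tensorFormCochain_v_apply,
    tensorFormCochain_v_apply, ConcreteCategory.comp_apply,
    tensorObj_d_ι_apply (q' := -(q - 1)) _ rfl (by lia) hn, map_add, smul_add, add_comm]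
  congr 1
  have : q.negOnePow = m'.negOnePow * p.negOnePow := by
    rw [← Int.negOnePow_add, ← hpq, add_comm]
  rw [this, mul_smul, Units.smul_def p.negOnePow, Units.smul_def p.negOnePow, map_zsmul]

lemma tensorFormCochain_v_congr {m : ℤ} (α : Cochain K (dualComplex E M) m) {p q q' : ℤ}
    (hq : q = q') (h : p + m = q) (h' : p + m = q') (k : K.X p) (x : M.X (-q)) :
    dualApply (α.v p q' h' k) ((M.XIsoOfEq (by rw [hq])).hom x) = dualApply (α.v p q h k) x := by
  subst hq
  simp

lemma tensorFormCochain_injective {n m : ℤ} (h : n + m = 0)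
    {Φ Ψ : (HomologicalComplex.tensorObj K M).X n ⟶ E}
    (e : tensorFormCochain m h Φ = tensorFormCochain m h Ψ) : Φ = Ψ := by
  apply HomologicalComplex.mapBifunctor.hom_ext
  intro p q hpq
  obtain ⟨q, rfl⟩ : ∃ q', q = -q' := ⟨-q, by simp⟩
  have hpq' : p + -q = n := hpq
  apply ModuleCat.hom_ext
  apply TensorProduct.ext'
  intro k x
  have := congr(dualApply (($e).v p q (by lia) k) x)
  rwa [tensorFormCochain_v_apply, tensorFormCochain_v_apply] at this

lemma tensorFormCochain_surjective {n m : ℤ} (h : n + m = 0)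
    (α : Cochain K (dualComplex E M) m) :
    ∃ Φ : (HomologicalComplex.tensorObj K M).X n ⟶ E, tensorFormCochain m h Φ = α := by
  refine ⟨HomologicalComplex.mapBifunctorDesc fun p q hpq ↦ ModuleCat.ofHom
    (TensorProduct.lift ((LinearMap.lcomp R E
      (M.XIsoOfEq (show q = - - q by simp)).hom.hom).comp
      (dualApply.comp (α.v p (-q) (by change p + q = n at hpq; lia)).hom))), ?_⟩
  ext p q hpq k
  apply LinearMap.ext
  intro x
  change dualApply ((tensorFormCochain m h _).v p q hpq k) x = dualApply (α.v p q hpq k) x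
  rw [tensorFormCochain_v_apply, ← ConcreteCategory.comp_apply,
    HomologicalComplex.ι_mapBifunctorDesc]
  exact tensorFormCochain_v_congr α (by simp) hpq _ k x

@[simp]
lemma tensorFormCochain_zero {n m : ℤ} (h : n + m = 0) :
    tensorFormCochain m h (0 : (HomologicalComplex.tensorObj K M).X n ⟶ E) = 0 := by
  ext p q hpq k
  apply LinearMap.ext
  intro x
  exact tensorFormCochain_v_apply m h 0 p q hpq k x

lemma tensorFormCochain_add {n m : ℤ} (h : n + m = 0)
    (Φ Ψ : (HomologicalComplex.tensorObj K M).X n ⟶ E) :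
    tensorFormCochain m h (Φ + Ψ) = tensorFormCochain m h Φ + tensorFormCochain m h Ψ := by
  ext p q hpq k
  apply LinearMap.ext
  intro x
  exact tensorFormCochain_v_apply m h (Φ + Ψ) p q hpq k x

lemma tensorFormCochain_smul {n m : ℤ} (h : n + m = 0) (r : R)
    (Φ : (HomologicalComplex.tensorObj K M).X n ⟶ E) :
    tensorFormCochain m h (r • Φ) = r • tensorFormCochain m h Φ := by
  ext p q hpq k
  apply LinearMap.ext
  intro x
  exact tensorFormCochain_v_apply m h (r • Φ) p q hpq k x

lemma tensorFormCochain_units_smul {n m : ℤ} (h : n + m = 0) (r : ℤˣ)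
    (Φ : (HomologicalComplex.tensorObj K M).X n ⟶ E) :
    tensorFormCochain m h (r • Φ) = r • tensorFormCochain m h Φ := by
  ext p q hpq k
  apply LinearMap.ext
  intro x
  exact tensorFormCochain_v_apply m h (r • Φ) p q hpq k x

section Forms

variable (T : Cpx R) {n n' : ℤ}

lemma homologyι_comp_surjective [Injective E] (φ : T.homology n ⟶ E) :
    ∃ ω : T.opcycles n ⟶ E, T.homologyι n ≫ ω = φ :=
  ⟨Injective.factorThru φ (T.homologyι n), Injective.comp_factorThru _ _⟩

/-- Homology is the kernel of opcycles → X n', and forms into an injective E keep this sequence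
exact. -/
lemma homologyι_comp_eq_zero_iff [Injective E] (hn : n + 1 = n') (ω : T.opcycles n ⟶ E) :
    T.homologyι n ≫ ω = 0 ↔ ∃ Ψ : T.X n' ⟶ E, T.fromOpcycles n n' ≫ Ψ = ω := by
  have hn' : (ComplexShape.up ℤ).next n = n' := by simp [hn]
  refine ⟨fun h ↦ ?_, ?_⟩
  · have hS : (ShortComplex.mk (T.homologyι n) (T.fromOpcycles n n') (by simp)).Exact :=
      ShortComplex.exact_of_f_is_kernel _ (T.homologyIsKernel n n' hn')
    exact ⟨hS.descToInjective ω h, hS.comp_descToInjective ω h⟩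
  · rintro ⟨Ψ, rfl⟩
    simp

lemma exists_pOpcycles_comp_eq (hn : n' + 1 = n) (Φ : T.X n ⟶ E) (h : T.d n' n ≫ Φ = 0) :
    ∃ ω : T.opcycles n ⟶ E, T.pOpcycles n ≫ ω = Φ :=
  ⟨T.descOpcycles Φ n' (by simp [← hn]) h, by simp⟩

end Forms

/-- A linear form on `K ⊗ M` vanishing on boundaries defines a cocycle `K ⟶ Hom_R(M, E)`. -/
def tensorFormCocycle {n m : ℤ} (h : n + m = 0)
    (ω : (HomologicalComplex.tensorObj K M).opcycles n ⟶ E) : Cocycle K (dualComplex E M) m :=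
  Cocycle.mk (tensorFormCochain m h ((HomologicalComplex.tensorObj K M).pOpcycles n ≫ ω)) (m + 1)
    rfl (by
      rw [δ_tensorFormCochain (n' := n - 1) h (by lia) (by lia),
        HomologicalComplex.d_pOpcycles_assoc, zero_comp, tensorFormCochain_zero, smul_zero])

lemma tensorFormCocycle_surjective {n m : ℤ} (h : n + m = 0)
    (α : Cocycle K (dualComplex E M) m) :
    ∃ ω : (HomologicalComplex.tensorObj K M).opcycles n ⟶ E, tensorFormCocycle h ω = α := by
  obtain ⟨Φ, hΦ⟩ := tensorFormCochain_surjective h α.1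
  have h' : (n - 1) + (m + 1) = 0 := by lia
  have hα := Cocycle.δ_eq_zero α (m + 1)
  rw [← hΦ, δ_tensorFormCochain h h' (by lia), smul_eq_zero_iff_eq] at hα
  obtain ⟨ω, rfl⟩ := exists_pOpcycles_comp_eq _ (by lia) Φ
    (tensorFormCochain_injective h' (hα.trans (tensorFormCochain_zero h').symm))
  exact ⟨ω, by ext1; exact hΦ⟩

variable {n : ℤ} [K.IsKProjective] [Injective E]

/-- A form on homology extends to opcycles because E is injective, hence gives a cocycle ω.
Divisibility of its derived class by r gives ω' with ω - r ω' a coboundary, that is, zero on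
homology. -/
lemma exists_smul_eq_of_derived {m : ℤ} (hnm : n + m = 0) (r : R)
    (h : ∀ f : Q.obj K ⟶ (Q.obj (dualComplex E M))⟦m⟧, ∃ g, f = r • g)
    (φ : (HomologicalComplex.tensorObj K M).homology n ⟶ E) : ∃ ψ, φ = r • ψ := by
  obtain ⟨ω, rfl⟩ := homologyι_comp_surjective _ φ
  obtain ⟨g, hg⟩ := h (derivedClass (tensorFormCocycle hnm ω))
  obtain ⟨β, rfl⟩ := derivedClass_surjective g
  obtain ⟨ω', rfl⟩ := tensorFormCocycle_surjective hnm β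
  have h0 : derivedClass (tensorFormCocycle hnm (ω - r • ω')) = 0 := by
    have : tensorFormCocycle hnm ω = tensorFormCocycle hnm (ω - r • ω') +
        r • tensorFormCocycle hnm ω' := by
      ext1
      rw [Cocycle.coe_add, Cocycle.coe_smul]
      change tensorFormCochain _ hnm _ = tensorFormCochain _ hnm _ + r • tensorFormCochain _ hnm _
      rw [← tensorFormCochain_smul, ← tensorFormCochain_add]
      simp
    rw [this, derivedClass_add, derivedClass_smul] at hg
    simpa using hg
  obtain ⟨γ, hγ⟩ := (derivedClass_eq_zero_iff _).1 h0
  have hn : (n + 1) + (m - 1) = 0 := by lia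
  obtain ⟨Ψ, rfl⟩ := tensorFormCochain_surjective hn γ
  rw [δ_tensorFormCochain hn hnm rfl, ← tensorFormCochain_units_smul] at hγ
  have := tensorFormCochain_injective hnm hγ
  refine ⟨HomologicalComplex.homologyι _ n ≫ ω', ?_⟩
  have h1 := (homologyι_comp_eq_zero_iff _ rfl (ω - r • ω')).2 ⟨m.negOnePow • Ψ, by
    rw [← cancel_epi (HomologicalComplex.pOpcycles _ n), ← this]
    simp⟩
  simpa [sub_eq_zero] using h1

lemma tensorObj_forms_eq_zero_iff {m : ℤ} (hnm : n + m = 0) :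
    (∀ φ : (HomologicalComplex.tensorObj K M).homology n ⟶ E, φ = 0) ↔
      ExtVanish (Q.obj K) (Q.obj (dualComplex E M)) m := by
  refine ⟨fun h ↦ extVanish_Q_iff.2 fun α ↦ ?_, fun h φ ↦ ?_⟩
  · obtain ⟨ω, rfl⟩ := tensorFormCocycle_surjective hnm α
    obtain ⟨Ψ, rfl⟩ := (homologyι_comp_eq_zero_iff _ rfl ω).1 (h _)
    have hn : (n + 1) + (m - 1) = 0 := by lia
    refine ⟨m.negOnePow • tensorFormCochain _ hn Ψ, ?_⟩
    rw [δ_units_smul, δ_tensorFormCochain hn hnm rfl, smul_smul, Int.units_mul_self, one_smul]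
    change tensorFormCochain _ hnm _ = tensorFormCochain _ hnm _
    simp
  -- Divisibility by the scalar 0 is vanishing.
  · obtain ⟨ψ, hψ⟩ := exists_smul_eq_of_derived hnm (0 : R)
      (fun f ↦ ⟨0, by rw [h f, smul_zero]⟩) φ
    rw [hψ, zero_smul]

end Dual

/-! ### Tor vanishing as Ext vanishing into character duals. -/

section Character

variable (R : Type u) [CommRing R]

/-- The character module of `B`. -/
def charModule (B : Type u) [AddCommGroup B] [Module R B] : ModuleCat.{u} R :=
  ModuleCat.of R (CharacterModule B)

instance (B : Type u) [AddCommGroup B] [Module R B] [Module.Flat R B] :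
    Injective (charModule R B) := by
  have : Module.Injective R (CharacterModule B) :=
    Module.Flat.iff_characterModule_injective.1 inferInstance
  exact Module.injective_object_of_injective_module R (CharacterModule B)

variable {R}

/-- Currying identifies Hom(V, B^∨) with the characters of V ⊗ B, and characters separate points. B
= R tests V itself; B a localization of R tests the localization of V. -/
lemma forall_charModule_eq_zero_iff (V : ModuleCat.{u} R) (B : Type u) [AddCommGroup B]
    [Module R B] : (∀ φ : V ⟶ charModule R B, φ = 0) ↔ Subsingleton (TensorProduct R V B) := by
  let e := CharacterModule.homEquiv (R := R) (A := V) (B := B)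
  refine ⟨fun h ↦ subsingleton_of_forall_eq 0 fun x ↦ ?_, fun h φ ↦ ?_⟩
  · refine CharacterModule.eq_zero_of_character_apply fun c ↦ ?_
    obtain ⟨φ, rfl⟩ := e.surjective c
    have : φ = 0 := congr($(h (ModuleCat.ofHom φ)).hom)
    rw [this, map_zero]
    rfl
  · apply ModuleCat.hom_ext
    apply e.injective
    ext x
    rw [Subsingleton.elim x 0, map_zero, map_zero]

lemma isZero_iff_forall_charModule (V : ModuleCat.{u} R) :
    IsZero V ↔ ∀ φ : V ⟶ charModule R R, φ = 0 := by
  rw [forall_charModule_eq_zero_iff, ModuleCat.isZero_iff_subsingleton,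
    (TensorProduct.rid R V).toEquiv.subsingleton_congr]

lemma exists_charModule_apply_ne_zero {V : ModuleCat.{u} R} {v : V} (hv : v ≠ 0) :
    ∃ φ : V ⟶ charModule R R, φ v ≠ 0 := by
  let e := CharacterModule.homEquiv (R := R) (A := V) (B := R)
  obtain ⟨c, hc⟩ := CharacterModule.exists_character_apply_ne_zero_of_ne_zero
    (a := TensorProduct.tmul R v (1 : R))
    (fun h ↦ hv (by simpa using congr(TensorProduct.rid R V $h)))
  obtain ⟨φ, rfl⟩ := e.surjective c
  exact ⟨ModuleCat.ofHom φ, fun h ↦ hc (by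
    have : φ v = 0 := h
    change φ v 1 = 0
    rw [this]
    rfl)⟩

/-- The character dual of a complex. -/
abbrev charDual (M : Cpx R) : Cpx R := dualComplex (charModule R R) M

lemma isZero_derivedTensor_homology_iff (N : ModuleCat.{u} R) (M : Cpx R) {n m : ℤ}
    (h : n + m = 0) : IsZero ((derivedTensor N M).homology n) ↔
      ModExtVanish N (Q.obj (charDual M)) m :=
  have := isKProjective_projRes N
  (isZero_iff_forall_charModule _).trans <| (tensorObj_forms_eq_zero_iff h).trans
    (extVanish_congr_left (projResIso N))

lemma subsingleton_derivedTensor_homology_iff (N : ModuleCat.{u} R) (M : Cpx R) {n m : ℤ}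
    (h : n + m = 0) (B : Type u) [AddCommGroup B] [Module R B] [Module.Flat R B] :
    Subsingleton (TensorProduct R ((derivedTensor N M).homology n) B) ↔
      ModExtVanish N (Q.obj (dualComplex (charModule R B) M)) m :=
  have := isKProjective_projRes N
  (forall_charModule_eq_zero_iff _ _).symm.trans <| (tensorObj_forms_eq_zero_iff h).trans
    (extVanish_congr_left (projResIso N))

/-- If every `N ⟶ M^∨⟦-n⟧` is divisible by `r`, then multiplication by `r` is injective on
`Hⁿ(N ⊗ᴸ M)`. -/
lemma smul_derivedTensor_homology_injective (N : ModuleCat.{u} R) (M : Cpx R) {n m : ℤ}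
    (hnm : n + m = 0) (r : R)
    (h : ∀ f : (DerivedCategory.singleFunctor (ModuleCat.{u} R) 0).obj N ⟶
      (Q.obj (charDual M))⟦m⟧, ∃ g, f = r • g)
    (v : (derivedTensor N M).homology n) (hv : r • v = 0) : v = 0 := by
  have := isKProjective_projRes N
  by_contra hv'
  obtain ⟨φ, hφ⟩ := exists_charModule_apply_ne_zero hv'
  obtain ⟨ψ, rfl⟩ := exists_smul_eq_of_derived hnm r (fun f ↦ by
    obtain ⟨g, hg⟩ := h ((projResIso N).inv ≫ f)
    refine ⟨(projResIso N).hom ≫ g, ?_⟩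
    have := Linear.comp_smul _ _ _ (projResIso N).hom r g
    rw [← hg, Iso.hom_inv_id_assoc] at this
    exact this) φ
  refine hφ ?_
  change r • ψ.hom v = 0
  exact (ψ.hom.map_smul r v).symm.trans ((congrArg ψ.hom hv).trans (map_zero _))

end Character

/-! ### Dévissage along short exact sequences and prime filtrations. -/

section ShortExactSequences

variable {R : Type u} [CommRing R] {S : ShortComplex (ModuleCat.{u} R)}
  {Y : DerivedCategory (ModuleCat.{u} R)} {n : ℤ}

lemma ModExtVanish.X₂ (hS : S.ShortExact) (h₁ : ModExtVanish S.X₁ Y n)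
    (h₃ : ModExtVanish S.X₃ Y n) : ModExtVanish S.X₂ Y n :=
  ExtVanish.obj₂ h₁ h₃ hS.singleTriangle_distinguished

lemma ModExtVanish.X₃ (hS : S.ShortExact) (h₁ : ModExtVanish S.X₁ Y n)
    (h₂ : ModExtVanish S.X₂ Y (n + 1)) : ModExtVanish S.X₃ Y (n + 1) :=
  ExtVanish.obj₃ h₁ h₂ hS.singleTriangle_distinguished

lemma ModExtVanish.congr {N N' : ModuleCat.{u} R} (h : ModExtVanish N Y n) (e : N ≅ N') :
    ModExtVanish N' Y n :=
  ExtVanish.congr_left h ((DerivedCategory.singleFunctor _ 0).mapIso e)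

lemma modExtVanish_of_isZero {N : ModuleCat.{u} R} (h : IsZero N) : ModExtVanish N Y n :=
  fun _ ↦ ((DerivedCategory.singleFunctor _ 0).map_isZero h).eq_of_src _ _

/-- In the sequence 0 → N → N → N/rN → 0 the obstruction to dividing f by r lies in Ext^(n+1)(N/rN,
Y). -/
lemma ModExtVanish.exists_eq_smul {N : Type u} [AddCommGroup N] [Module R N] {r : R}
    (hr : IsSMulRegular N r)
    (h : ModExtVanish (ModuleCat.of R (QuotSMulTop r N)) Y (n + 1))
    (f : (DerivedCategory.singleFunctor _ 0).obj (ModuleCat.of R N) ⟶ Y⟦n⟧) : ∃ g, f = r • g := by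
  obtain ⟨g, hg⟩ := ExtVanish.exists_eq_mor₁_comp (n := n) (Y := Y) h
    (IsSMulRegular.smulShortComplex_shortExact (M := ModuleCat.of R N) hr).singleTriangle_distinguished f
  have h₁ : (DerivedCategory.singleFunctor (ModuleCat.{u} R) 0).map (r • 𝟙 (ModuleCat.of R N)) =
      r • 𝟙 _ := (Functor.map_smul _ _ _).trans (congrArg _ (CategoryTheory.Functor.map_id _ _))
  exact ⟨g, hg.trans <| (congrArg (fun φ ↦ φ ≫ g) h₁).trans <|
    (Linear.smul_comp _ _ _ _ _ _).trans (congrArg _ (Category.id_comp _))⟩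

/-- Vanishing for a finitely generated module can be checked on the residue domains of the
primes in its support. -/
lemma modExtVanish_of_support [IsNoetherianRing R] (N : Type u) [AddCommGroup N] [Module R N]
    [hN : Module.Finite R N]
    (h : ∀ q ∈ Module.support R N, ModExtVanish (ModuleCat.of R (R ⧸ q.asIdeal)) Y n) :
    ModExtVanish (ModuleCat.of R N) Y n := by
  revert h
  induction hN using IsNoetherianRing.induction_on_isQuotientEquivQuotientPrime R with
  | subsingleton N => exact fun _ ↦ modExtVanish_of_isZero (ModuleCat.isZero_of_subsingleton _)
  | quotient N p f =>
    intro h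
    refine (h p ?_).congr f.symm.toModuleIso
    rw [f.support_eq, Module.support_of_algebra]
    simp
  | exact N₁ N₂ N₃ f g hf hg hfg h₁ h₃ =>
    intro h
    rw [Module.support_of_exact hfg hf hg] at h
    exact ModExtVanish.X₂
      (S := ModuleCat.shortComplexOfCompEqZero f g hfg.linearMap_comp_eq_zero)
      (ModuleCat.shortComplex_shortExact _ hfg hf hg)
      (h₁ fun q hq ↦ h q (.inl hq)) (h₃ fun q hq ↦ h q (.inr hq))

lemma isSMulRegular_quotient_prime (p : PrimeSpectrum R) {s : R} (hs : s ∉ p.asIdeal) :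
    IsSMulRegular (R ⧸ p.asIdeal) s := by
  rw [isSMulRegular_iff_right_eq_zero_of_smul]
  intro x hx
  rw [Algebra.smul_def, mul_eq_zero] at hx
  exact hx.resolve_left fun h ↦ hs (Ideal.Quotient.eq_zero_iff_mem.1 h)

/-- A class v dies at p, so s v = 0 for some s outside p. The support of R/(p + sR) consists of
primes strictly above p, so the first hypothesis kills the cohomology of its tensor product with M
in degree n - 1, and multiplication by s is injective in degree n. -/
lemma isZero_homology_derivedTensor_of_localization [IsNoetherianRing R] (p : PrimeSpectrum R)
    (M : Cpx R) (n : ℤ)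
    (hq : ∀ q : PrimeSpectrum R, p < q →
      IsZero ((derivedTensor (ModuleCat.of R (R ⧸ q.asIdeal)) M).homology (n - 1)))
    (hp : Subsingleton (TensorProduct R
      ((derivedTensor (ModuleCat.of R (R ⧸ p.asIdeal)) M).homology n)
      (Localization.AtPrime p.asIdeal))) :
    IsZero ((derivedTensor (ModuleCat.of R (R ⧸ p.asIdeal)) M).homology n) := by
  rw [ModuleCat.isZero_iff_subsingleton]
  refine subsingleton_of_forall_eq 0 fun v ↦ ?_
  have := ((LocalizedModule.equivTensorProduct p.asIdeal.primeCompl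
    ((derivedTensor (ModuleCat.of R (R ⧸ p.asIdeal)) M).homology n)).toEquiv.trans
    (TensorProduct.comm R _ _).toEquiv).subsingleton
  obtain ⟨s, hs, hv⟩ := LocalizedModule.subsingleton_iff.1 this v
  refine smul_derivedTensor_homology_injective _ M (m := -n) (by simp) s ?_ v hv
  refine ModExtVanish.exists_eq_smul (isSMulRegular_quotient_prime p hs) ?_
  refine modExtVanish_of_support _ fun q hq' ↦ ?_
  rw [Module.support_quotSMulTop, Module.support_of_algebra] at hq'
  refine (isZero_derivedTensor_homology_iff _ M (by ring)).1 (hq q (lt_of_le_of_ne ?_ ?_))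
  · simpa using hq'.1
  · rintro rfl
    exact hs (by simpa using hq'.2)

end ShortExactSequences

/-! ### Localization of complexes and of the derived tensor product. -/

section Localization

variable {R : Type u} [CommRing R] (S : Submonoid R)

/-- Localization of complexes. -/
abbrev localizeCpx (M : Cpx R) : Cpx (Localization S) :=
  ((ModuleCat.localizedModuleFunctor.{u} S).mapHomologicalComplex (ComplexShape.up ℤ)).obj M

instance (M : Cpx R) (i : ℤ) : Module R ((localizeCpx S M).X i) :=
  inferInstanceAs (Module R ((M.X i).localizedModule S))

instance (M : Cpx R) (i : ℤ) : IsScalarTower R (Localization S) ((localizeCpx S M).X i) :=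
  inferInstanceAs (IsScalarTower R (Localization S) ((M.X i).localizedModule S))

/-- The localization map in a degree. -/
def localizeMk (M : Cpx R) (i : ℤ) : M.X i →ₗ[R] (localizeCpx S M).X i :=
  (M.X i).localizedModuleMkLinearMap S

lemma isBaseChange_localizeMk (M : Cpx R) (i : ℤ) :
    IsBaseChange (Localization S) (localizeMk S M i) :=
  have : IsLocalizedModule S (localizeMk S M i) :=
    ModuleCat.localizedModule_isLocalizedModule _ _
  IsLocalizedModule.isBaseChange S _ _

lemma localizeCpx_d_apply (M : Cpx R) (i j : ℤ) (x : M.X i) :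
    (localizeCpx S M).d i j (localizeMk S M i x) = localizeMk S M j (M.d i j x) :=
  IsLocalizedModule.map_apply S ((M.X i).localizedModuleMkLinearMap S)
    ((M.X j).localizedModuleMkLinearMap S) (M.d i j).hom x

variable {S} {E : Type u} [AddCommGroup E] [Module R E] [Module (Localization S) E]
  [IsScalarTower R (Localization S) E] {K M : Cpx R}

lemma cochain_dualComplex_ext {E : ModuleCat.{u} R} {m : ℤ} {α β : Cochain K (dualComplex E M) m}
    (h : ∀ (p q : ℤ) (hpq : p + m = q) (k : K.X p) (x : M.X (-q)),
      dualApply (α.v p q hpq k) x = dualApply (β.v p q hpq k) x) : α = β := by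
  ext p q hpq : 2
  exact LinearMap.ext fun k ↦ LinearMap.ext fun x ↦ h p q hpq k x

/-- Restriction of cochains along the localization maps. -/
def restrictCochain {m : ℤ}
    (z : Cochain (localizeCpx S K) (dualComplex (ModuleCat.of _ E) (localizeCpx S M)) m) :
    Cochain K (dualComplex (ModuleCat.of R E) M) m :=
  Cochain.mk fun p q hpq ↦ ModuleCat.ofHom <| LinearMap.mk₂ R
    (fun k x ↦ dualApply (z.v p q hpq (localizeMk S K p k)) (localizeMk S M (-q) x))
    (fun _ _ _ ↦ by simp only [map_add, LinearMap.add_apply])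
    (fun r k x ↦ by
      rw [map_smul, ← algebraMap_smul (Localization S) r, map_smul, map_smul,
        LinearMap.smul_apply, algebraMap_smul])
    (fun _ _ _ ↦ by simp only [map_add])
    (fun r k x ↦ by
      rw [map_smul, ← algebraMap_smul (Localization S) r, map_smul, algebraMap_smul])

lemma restrictCochain_v_apply {m : ℤ}
    (z : Cochain (localizeCpx S K) (dualComplex (ModuleCat.of _ E) (localizeCpx S M)) m)
    (p q : ℤ) (hpq : p + m = q) (k : K.X p) (x : M.X (-q)) :
    dualApply ((restrictCochain z).v p q hpq k) x =
      dualApply (z.v p q hpq (localizeMk S K p k)) (localizeMk S M (-q) x) := rfl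

lemma δ_restrictCochain {n m : ℤ} (hnm : n + 1 = m)
    (z : Cochain (localizeCpx S K) (dualComplex (ModuleCat.of _ E) (localizeCpx S M)) n) :
    δ n m (restrictCochain z) = restrictCochain (δ n m z) := by
  refine cochain_dualComplex_ext fun p q hpq k x ↦ ?_
  rw [restrictCochain_v_apply, δ_v n m hnm _ p q hpq _ _ rfl rfl,
    δ_v n m hnm _ p q hpq _ _ rfl rfl]
  change dualApply ((dualComplex _ M).d (q - 1) q ((restrictCochain z).v p (q - 1) _ k)) x +
    m.negOnePow • dualApply ((restrictCochain z).v (p + 1) q _ (K.d p (p + 1) k)) x =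
    dualApply ((dualComplex _ _).d (q - 1) q (z.v p (q - 1) _ _)) _ +
    m.negOnePow • dualApply (z.v (p + 1) q _ ((localizeCpx S K).d p (p + 1) _)) _
  rw [dualApply_d, dualApply_d, restrictCochain_v_apply, restrictCochain_v_apply,
    localizeCpx_d_apply, localizeCpx_d_apply]

lemma restrictCochain_injective {m : ℤ} : Function.Injective
    (restrictCochain (S := S) (E := E) (K := K) (M := M) (m := m)) := by
  intro z z' h
  ext p q hpq : 2
  refine (isBaseChange_localizeMk S K p).algHom_ext _ _ fun k ↦ ?_
  refine (isBaseChange_localizeMk S M (-q)).algHom_ext (Q := E) (dualApply (z.v p q hpq _))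
    (dualApply (z'.v p q hpq _)) fun x ↦ ?_
  rw [← restrictCochain_v_apply, h, restrictCochain_v_apply]

lemma restrictCochain_surjective {m : ℤ} : Function.Surjective
    (restrictCochain (S := S) (E := E) (K := K) (M := M) (m := m)) := by
  intro z
  let b (p q : ℤ) (hpq : p + m = q) :
      (localizeCpx S K).X p →ₗ[Localization S]
        (localizeCpx S M).X (-q) →ₗ[Localization S] E :=
    (isBaseChange_localizeMk S K p).lift
      { toFun k := (isBaseChange_localizeMk S M (-q)).lift (dualApply (z.v p q hpq k))
        map_add' k k' := by
          refine (isBaseChange_localizeMk S M (-q)).algHom_ext _ _ fun x ↦ ?_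
          simp [IsBaseChange.lift_eq]
        map_smul' r k := by
          refine (isBaseChange_localizeMk S M (-q)).algHom_ext _ _ fun x ↦ ?_
          simp [IsBaseChange.lift_eq] }
  refine ⟨Cochain.mk fun p q hpq ↦ ModuleCat.ofHom (b p q hpq), ?_⟩
  refine cochain_dualComplex_ext fun p q hpq k x ↦ ?_
  change b p q hpq (localizeMk S K p k) (localizeMk S M (-q) x) = _
  simp [b, IsBaseChange.lift_eq]

/-- E is already a module over the localization, so R-bilinear pairings with values in E extend
uniquely to the localized terms: `restrictCochain` identifies the two Hom complexes. -/
lemma extVanish_localizeCpx_iff [K.IsKProjective] [(localizeCpx S K).IsKProjective] (m : ℤ) :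
    ExtVanish (Q.obj (localizeCpx S K))
      (Q.obj (dualComplex (ModuleCat.of (Localization S) E) (localizeCpx S M))) m ↔
    ExtVanish (Q.obj K) (Q.obj (dualComplex (ModuleCat.of R E) M)) m := by
  have h0 {j : ℤ} : restrictCochain (S := S) (E := E) (K := K) (M := M) (m := j) 0 = 0 := by
    ext
    rfl
  rw [extVanish_Q_iff, extVanish_Q_iff]
  refine ⟨fun h z ↦ ?_, fun h z ↦ ?_⟩
  · obtain ⟨z', hz'⟩ := restrictCochain_surjective (S := S) z.1
    obtain ⟨w, hw⟩ := h ⟨z', (Cocycle.mem_iff m (m + 1) rfl z').2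
      (restrictCochain_injective (by
        rw [← δ_restrictCochain rfl, hz', Cocycle.δ_eq_zero z, h0]))⟩
    exact ⟨restrictCochain w, by
      rw [δ_restrictCochain (by simp), hw]
      exact hz'⟩
  · obtain ⟨w, hw⟩ := h ⟨restrictCochain z.1, (Cocycle.mem_iff m (m + 1) rfl _).2 (by
      rw [δ_restrictCochain rfl, Cocycle.δ_eq_zero z, h0])⟩
    obtain ⟨w, rfl⟩ := restrictCochain_surjective (S := S) w
    exact ⟨w, restrictCochain_injective (by rw [← δ_restrictCochain (by simp), hw])⟩

/-- The localized projective resolution represents the localized module. -/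
def localizeProjResIso (N : ModuleCat.{u} R) :
    Q.obj (localizeCpx S (projRes N)) ≅
      (DerivedCategory.singleFunctor _ 0).obj (N.localizedModule S) :=
  have h (_ : QuasiIso (projectiveResolution N).π') :
      QuasiIso (((ModuleCat.localizedModuleFunctor.{u} S).mapHomologicalComplex
        (ComplexShape.up ℤ)).map (projectiveResolution N).π') := inferInstance
  have : IsIso (Q.map (((ModuleCat.localizedModuleFunctor.{u} S).mapHomologicalComplex
      (ComplexShape.up ℤ)).map (projectiveResolution N).π')) :=
    Localization.inverts Q (HomologicalComplex.quasiIso _ (ComplexShape.up ℤ)) _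
      (h inferInstance)
  @asIso _ _ _ _ _ this ≪≫
    Q.mapIso ((HomologicalComplex.singleMapHomologicalComplex
      (ModuleCat.localizedModuleFunctor.{u} S) (ComplexShape.up ℤ) 0).app N)

instance isKProjective_localizeCpx_projRes (N : ModuleCat.{u} R) :
    (localizeCpx S (projRes N)).IsKProjective := by
  have h1 : (projRes N).IsStrictlyLE 0 :=
    inferInstanceAs ((projectiveResolution N).cochainComplex.IsStrictlyLE 0)
  have h2 (n : ℤ) : Projective ((projRes N).X n) :=
    inferInstanceAs (Projective ((projectiveResolution N).cochainComplex.X n))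
  have h3 : (localizeCpx S (projRes N)).IsStrictlyLE 0 :=
    (isStrictlyLE_iff _ _).2 fun i hi ↦
      (ModuleCat.localizedModuleFunctor.{u} S).map_isZero ((isStrictlyLE_iff _ _).1 h1 i hi)
  have h4 (n : ℤ) : Projective ((localizeCpx S (projRes N)).X n) :=
    (ModuleCat.localizedModuleFunctor.{u} S).projective_obj_of_projective (h2 n)
  exact isKProjective_of_projective _ 0

instance isScalarTower_characterModule :
    IsScalarTower R (Localization S) (CharacterModule (Localization S)) where
  smul_assoc r a c := by
    ext x
    change c ((r • a) • x) = c (a • r • x)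
    rw [smul_comm a r x, smul_assoc]

-- Both sides are vanishing statements for forms valued in the character module of `Localization S`.
-- It is injective over `Localization S`, and over R as well because `Localization S` is R-flat.
variable (S) in
lemma isZero_derivedTensor_localizedModule_iff (N : ModuleCat.{u} R) (M : Cpx R) (n : ℤ) :
    IsZero ((derivedTensor (N.localizedModule S) (localizeCpx S M)).homology n) ↔
      Subsingleton (TensorProduct R ((derivedTensor N M).homology n) (Localization S)) := by
  have := isKProjective_projRes N
  have := IsLocalization.flat (Localization S) S
  rw [isZero_derivedTensor_homology_iff _ _ (m := -n) (by simp),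
    subsingleton_derivedTensor_homology_iff _ _ (m := -n) (by simp)]
  exact (extVanish_congr_left (localizeProjResIso N)).symm.trans <|
    (extVanish_localizeCpx_iff _).trans (extVanish_congr_left (projResIso N))

/-- The localization of `R ⧸ p` at `p` is the residue field. -/
def localizedQuotientIso (p : Ideal R) [p.IsPrime] :
    (ModuleCat.of R (R ⧸ p)).localizedModule p.primeCompl ≅
      ModuleCat.of (Localization.AtPrime p)
        (Localization.AtPrime p ⧸ IsLocalRing.maximalIdeal (Localization.AtPrime p)) :=
  have : IsLocalizedModule p.primeCompl
      ((ModuleCat.of R (R ⧸ p)).localizedModuleMkLinearMap p.primeCompl) :=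
    ModuleCat.localizedModule_isLocalizedModule _ _
  LinearEquiv.toModuleIso <|
    (LinearEquiv.extendScalarsOfIsLocalization p.primeCompl (Localization.AtPrime p)
      (IsLocalizedModule.linearEquiv p.primeCompl
        ((ModuleCat.of R (R ⧸ p)).localizedModuleMkLinearMap p.primeCompl)
        (Submodule.toLocalizedQuotient' (Localization.AtPrime p) p.primeCompl
          (Algebra.linearMap R (Localization.AtPrime p)) p))).trans
    (Submodule.quotEquivOfEq _ _ (by
      rw [Ideal.localized'_eq_map, Localization.AtPrime.map_eq_maximalIdeal]))

lemma isZero_derivedTensor_congr {N N' : ModuleCat.{u} R} (e : N ≅ N') (M : Cpx R) (n : ℤ) :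
    IsZero ((derivedTensor N M).homology n) ↔ IsZero ((derivedTensor N' M).homology n) := by
  rw [isZero_derivedTensor_homology_iff _ _ (m := -n) (by simp),
    isZero_derivedTensor_homology_iff _ _ (m := -n) (by simp)]
  exact ⟨fun h ↦ h.congr e, fun h ↦ h.congr e.symm⟩

end Localization

/-! ### Comparison of local and global width. -/

section WidthFormula

variable {R : Type u} [CommRing R]

lemma isZero_derivedTensor_localize_iff (p : PrimeSpectrum R) (M : Cpx R) (n : ℤ) :
    IsZero ((derivedTensor (ModuleCat.of (Localization.AtPrime p.asIdeal)
      (Localization.AtPrime p.asIdeal ⧸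
        IsLocalRing.maximalIdeal (Localization.AtPrime p.asIdeal))) (localize p M)).homology n) ↔
      Subsingleton (TensorProduct R ((derivedTensor (ModuleCat.of R (R ⧸ p.asIdeal)) M).homology n)
        (Localization.AtPrime p.asIdeal)) :=
  (isZero_derivedTensor_congr (localizedQuotientIso p.asIdeal).symm _ _).trans
    (isZero_derivedTensor_localizedModule_iff p.asIdeal.primeCompl _ M n)

lemma le_cohSup {C : Type*} [Category* C] [Abelian C] {K : CochainComplex C ℤ} {n : ℤ}
    (h : ¬ IsZero (K.homology n)) : ((n : ℝ) : EReal) ≤ cohSup K :=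
  le_iSup₂_of_le n h le_rfl

lemma sub_localWidth (a : EReal) (p : PrimeSpectrum R) (M : Cpx R) :
    a - localWidth (Localization.AtPrime p.asIdeal) (localize p M) =
      a + cohSup (derivedTensor (ModuleCat.of (Localization.AtPrime p.asIdeal)
      (Localization.AtPrime p.asIdeal ⧸
        IsLocalRing.maximalIdeal (Localization.AtPrime p.asIdeal))) (localize p M)) := by
  rw [localWidth, width, sub_eq_add_neg, neg_neg]

lemma sub_width (a : EReal) (I : Ideal R) (M : Cpx R) :
    a - width I M = a + cohSup (derivedTensor (ModuleCat.of R (R ⧸ I)) M) := by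
  rw [width, sub_eq_add_neg, neg_neg]

/-- Finiteness of a allows it to be moved across the inequality without meeting ⊥ + ⊤. -/
lemma add_cohSup_le_iff {C : Type*} [Category* C] [Abelian C] {K : CochainComplex C ℤ}
    {a : EReal} (ha : a ≠ ⊥) (ha' : a ≠ ⊤) (b : EReal) :
    a + cohSup K ≤ b ↔ ∀ n : ℤ, ¬ IsZero (K.homology n) → a + ((n : ℝ) : EReal) ≤ b := by
  lift a to ℝ using ⟨ha', ha⟩
  have h (c : EReal) : (a : EReal) + c ≤ b ↔ c ≤ b - a := by
    rw [add_comm, EReal.le_sub_iff_add_le (by simp) (by simp)]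
  rw [h, cohSup, iSup₂_le_iff]
  simp [h]

lemma height_eq [IsNoetherianRing R] (p : PrimeSpectrum R) :
    ∃ d : ℕ, p.asIdeal.height = d ∧ height p = ((d : ℝ) : EReal) := by
  obtain ⟨d, hd⟩ := ENat.ne_top_iff_exists.1 (Ideal.height_ne_top_of_isPrime (I := p.asIdeal))
  refine ⟨d, hd.symm, ?_⟩
  rw [height, ← hd]
  simp only [ENat.toENNReal_coe]
  norm_cast

/-- The local and the global width give the same supremum against the height. -/
theorem iSup_height_sub_localWidth [IsNoetherianRing R] (M : Cpx R) :
    (⨆ p : PrimeSpectrum R,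
        height p - localWidth (Localization.AtPrime p.asIdeal) (localize p M)) =
      ⨆ p : PrimeSpectrum R, height p - width p.asIdeal M := by
  simp_rw [sub_localWidth, sub_width]
  refine le_antisymm (iSup_mono fun p ↦ ?_) (iSup_le fun p ↦ ?_)
  -- Cohomology over R_p is a localization of cohomology over R, so it vanishes wherever the latter
  -- does.
  · refine add_le_add le_rfl (iSup₂_le fun n hn ↦ le_cohSup fun h ↦ hn ?_)
    rw [isZero_derivedTensor_localize_iff]
    have := ModuleCat.isZero_iff_subsingleton.1 h
    infer_instance
  · obtain ⟨d, -, hd⟩ := height_eq p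
    rw [add_cohSup_le_iff (by rw [hd]; exact EReal.coe_ne_bot _) (by rw [hd]; exact EReal.coe_ne_top _)]
    clear d hd
    -- Primes satisfy the ascending chain condition, so the bound may be assumed at every strictly
    -- larger prime.
    have : WellFoundedGT (PrimeSpectrum R) :=
      StrictMono.wellFoundedGT (f := PrimeSpectrum.asIdeal) fun _ _ h ↦ h
    induction p using WellFoundedGT.induction with
    | ind p ih =>
    intro n hn
    obtain ⟨d, hd, hd'⟩ := height_eq p
    by_cases hp : Subsingleton (TensorProduct R
      ((derivedTensor (ModuleCat.of R (R ⧸ p.asIdeal)) M).homology n)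
        (Localization.AtPrime p.asIdeal))
    · have : ∃ q : PrimeSpectrum R, p < q ∧ ¬ IsZero
          ((derivedTensor (ModuleCat.of R (R ⧸ q.asIdeal)) M).homology (n - 1)) := by
        by_contra! h
        exact hn (isZero_homology_derivedTensor_of_localization p M n h hp)
      obtain ⟨q, hpq, hq⟩ := this
      refine le_trans ?_ (ih q hpq (n - 1) hq)
      obtain ⟨e, he, he'⟩ := height_eq q
      have h := Ideal.height_add_one_le_of_lt_of_isPrime (show p.asIdeal < q.asIdeal from hpq)
      rw [hd, he] at h
      have h : d + 1 ≤ e := by exact_mod_cast h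
      have h : (d : ℝ) + 1 ≤ e := by exact_mod_cast h
      rw [hd', he', ← EReal.coe_add, ← EReal.coe_add, EReal.coe_le_coe_iff]
      push_cast
      linarith
    · rw [← isZero_derivedTensor_localize_iff] at hp
      exact le_iSup_of_le p (add_le_add le_rfl (le_cohSup hp))

end WidthFormula

/-! ### Duality for bounded complexes of finitely generated projectives. -/

section StrictlyPerfect

variable {R : Type u} [CommRing R]

/-- Bounded complexes of finitely generated projective modules. -/
structure IsStrictlyPerfect (F : Cpx R) : Prop where
  finite (i : ℤ) : Module.Finite R (F.X i)
  projective (i : ℤ) : Module.Projective R (F.X i)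
  bounded : ∃ a b : ℤ, ∀ i : ℤ, ¬ (a ≤ i ∧ i ≤ b) → Subsingleton (F.X i)

lemma IsStrictlyPerfect.isKProjective {F : Cpx R} (hF : IsStrictlyPerfect F) :
    F.IsKProjective := by
  obtain ⟨a, b, h⟩ := hF.bounded
  have h1 : F.IsStrictlyLE b := (isStrictlyLE_iff _ _).2 fun i hi ↦
    have := h i (by lia)
    ModuleCat.isZero_of_subsingleton _
  have h2 (i : ℤ) : Projective (F.X i) :=
    have := hF.projective i
    ModuleCat.projective_of_categoryTheory_projective (F.X i)
  exact isKProjective_of_projective _ b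

variable (R) in
/-- The linear dual of a complex. -/
abbrev linearDual (F : Cpx R) : Cpx R := dualComplex (ModuleCat.of R R) F

lemma IsStrictlyPerfect.linearDual {F : Cpx R} (hF : IsStrictlyPerfect F) :
    IsStrictlyPerfect (linearDual R F) where
  finite i :=
    have := hF.finite (-i)
    have := hF.projective (-i)
    inferInstanceAs (Module.Finite R (Module.Dual R (F.X (-i))))
  projective i :=
    have := hF.finite (-i)
    have := hF.projective (-i)
    inferInstanceAs (Module.Projective R (Module.Dual R (F.X (-i))))
  bounded := by
    obtain ⟨a, b, h⟩ := hF.bounded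
    refine ⟨-b, -a, fun i hi ↦ ?_⟩
    have := h (-i) (by lia)
    exact inferInstanceAs (Subsingleton (Module.Dual R (F.X (-i))))

variable {F M : Cpx R}

/-- `Cochain.single` as a linear map. -/
def singleLinear (p q n : ℤ) : (F.X p →ₗ[R] M.X q) →ₗ[R] Cochain F M n where
  toFun f := Cochain.single (ModuleCat.ofHom f) n
  map_add' f g := by
    ext p' q' h : 2
    by_cases hp : p' = p
    · subst hp
      by_cases hq : q' = q
      · subst hq
        simp
      · simp [Cochain.single_v_eq_zero' _ _ _ _ _ hq]
    · simp [Cochain.single_v_eq_zero _ _ _ _ _ hp]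
  map_smul' r f := by
    ext p' q' h : 2
    by_cases hp : p' = p
    · subst hp
      by_cases hq : q' = q
      · subst hq
        simp
      · simp [Cochain.single_v_eq_zero' _ _ _ _ _ hq]
    · simp [Cochain.single_v_eq_zero _ _ _ _ _ hp]

/-- Evaluation of a cochain as a linear map. -/
def vLinear (p q n : ℤ) (h : p + n = q) : Cochain F M n →ₗ[R] (F.X p →ₗ[R] M.X q) where
  toFun z := (z.v p q h).hom
  map_add' _ _ := rfl
  map_smul' _ _ := rfl

/-- The comparison map from `F^* ⊗ M` to `Hom(F, M)` on a summand. -/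
def dualTensorCochainAux (p q n : ℤ) :
    (linearDual R F).X p ⊗ M.X q ⟶ ModuleCat.of R (Cochain F M n) :=
  ModuleCat.ofHom ((p * q).negOnePow •
    (singleLinear (-p) q n).comp (dualTensorHom R (F.X (-p)) (M.X q)))

variable (F M) in
/-- The comparison map from `F^* ⊗ M` to `Hom(F, M)`. -/
def dualTensorCochain (n : ℤ) :
    (HomologicalComplex.tensorObj (linearDual R F) M).X n ⟶ ModuleCat.of R (Cochain F M n) :=
  HomologicalComplex.mapBifunctorDesc fun p q _ ↦ dualTensorCochainAux p q n

lemma dualTensorCochain_ι {p q n : ℤ} (h : p + q = n)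
    (t : TensorProduct R (Module.Dual R (F.X (-p))) (M.X q)) :
    dualTensorCochain F M n (HomologicalComplex.ιTensorObj (linearDual R F) M p q n h t) =
      (p * q).negOnePow • singleLinear (-p) q n (dualTensorHom R (F.X (-p)) (M.X q) t) := by
  have : HomologicalComplex.ιTensorObj (linearDual R F) M p q n h ≫ dualTensorCochain F M n =
    dualTensorCochainAux p q n := HomologicalComplex.ι_mapBifunctorDesc _ _ _ _
  exact congr($(this).hom t)

/-- The tensor product puts the sign (-1)^p on the differential of M, while δ leaves that term
unsigned and signs the differential of F. The factor (-1)^(pq) in the comparison map reconciles the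
two. -/
lemma δ_dualTensorCochain {n n' : ℤ} (hn : n + 1 = n')
    (t : (HomologicalComplex.tensorObj (linearDual R F) M).X n) :
    δ n n' (show Cochain F M n from dualTensorCochain F M n t) =
      dualTensorCochain F M n' ((HomologicalComplex.tensorObj (linearDual R F) M).d n n' t) := by
  suffices dualTensorCochain F M n ≫ ModuleCat.ofHom (δ_hom R F M n n') =
      (HomologicalComplex.tensorObj (linearDual R F) M).d n n' ≫ dualTensorCochain F M n' from
    congr($(this).hom t)
  apply HomologicalComplex.mapBifunctor.hom_ext
  intro p q hpq
  have hpq' : p + q = n := hpq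
  apply ModuleCat.hom_ext
  apply TensorProduct.ext'
  intro g x
  change δ n n' (show Cochain F M n from dualTensorCochain F M n
      (HomologicalComplex.ιTensorObj (linearDual R F) M p q n hpq (TensorProduct.tmul R g x))) =
    dualTensorCochain F M n' ((HomologicalComplex.tensorObj (linearDual R F) M).d n n'
      (HomologicalComplex.ιTensorObj (linearDual R F) M p q n hpq (TensorProduct.tmul R g x)))
  rw [tensorObj_d_ι_apply hpq' rfl rfl hn, map_add, Units.smul_def, map_zsmul]
  have h1 := dualTensorCochain_ι hpq (TensorProduct.tmul R g x)
  have h2 := dualTensorCochain_ι (F := F) (p := p + 1) (n := n') (by lia)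
    (TensorProduct.tmul R ((linearDual R F).d p (p + 1) g) x)
  have h3 := dualTensorCochain_ι (F := F) (n := n') (by lia)
    (TensorProduct.tmul R g (M.d q (q + 1) x))
  refine (congrArg (δ n n') h1).trans <| Eq.trans ?_ (congrArg₂ (fun a b ↦ a + p.negOnePow • b) h2 h3).symm
  have h4 : dualTensorHom R (F.X (-(p + 1))) (M.X q)
      (TensorProduct.tmul R ((linearDual R F).d p (p + 1) g) x) = (p + 1).negOnePow •
      (dualTensorHom R (F.X (-p)) (M.X q) (TensorProduct.tmul R g x)).comp
        (F.d (-(p + 1)) (-p)).hom := by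
    ext y
    change (dualApply ((linearDual R F).d p (p + 1) g) y) • x = (p + 1).negOnePow •
      ((dualApply g (F.d (-(p + 1)) (-p) y)) • x)
    rw [dualApply_d, smul_assoc]
  have h5 : dualTensorHom R (F.X (-p)) (M.X (q + 1))
      (TensorProduct.tmul R g (M.d q (q + 1) x)) =
      (M.d q (q + 1)).hom.comp
      (dualTensorHom R (F.X (-p)) (M.X q) (TensorProduct.tmul R g x)) := by
    ext y
    exact ((M.d q (q + 1)).hom.map_smul _ _).symm
  rw [δ_units_smul, h4, h5, Units.smul_def (p + 1).negOnePow, map_zsmul, ← Units.smul_def,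
    smul_smul, smul_smul, ← Int.negOnePow_add, ← Int.negOnePow_add]
  refine (congrArg _ (Cochain.δ_single _ n n' hn (-(p + 1)) (q + 1) (by lia) rfl)).trans ?_
  rw [smul_add, smul_smul, ← Int.negOnePow_add, add_comm]
  refine congrArg₂ (· + ·) (congrArg (· • _) ?_) (congrArg (· • _) ?_)
  · congr 1
    subst hn hpq'
    ring
  · rw [Int.negOnePow_eq_iff]
    exact ⟨-p, by ring⟩

/-- The comparison map between homomorphisms and tensor products, in a degree. -/
def dualTensorEquiv (hF : IsStrictlyPerfect F) (p q : ℤ) :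
    TensorProduct R (Module.Dual R (F.X (-p))) (M.X q) ≃ₗ[R] (F.X (-p) →ₗ[R] M.X q) :=
  have := hF.finite
  have := hF.projective
  LinearEquiv.ofBijective _ dualTensorHom_bijective

/-- The inverse of the comparison map, on a summand. -/
def cochainDualTensorAux (hF : IsStrictlyPerfect F) (p n : ℤ) :
    Cochain F M n →ₗ[R] (HomologicalComplex.tensorObj (linearDual R F) M).X n :=
  (p * (n - p)).negOnePow •
    (HomologicalComplex.ιTensorObj (linearDual R F) M p (n - p) n (by lia)).hom.comp
      ((dualTensorEquiv hF p (n - p)).symm.toLinearMap.comp (vLinear (-p) (n - p) n (by lia)))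

lemma cochainDualTensorAux_apply (hF : IsStrictlyPerfect F) (p n : ℤ) (z : Cochain F M n) :
    cochainDualTensorAux hF p n z = (p * (n - p)).negOnePow •
      HomologicalComplex.ιTensorObj (linearDual R F) M p (n - p) n (by lia)
        ((dualTensorEquiv hF p (n - p)).symm (vLinear (-p) (n - p) n (by lia) z)) := rfl

lemma dualTensorCochain_aux (hF : IsStrictlyPerfect F) (p n : ℤ) (z : Cochain F M n) :
    dualTensorCochain F M n (cochainDualTensorAux hF p n z) =
      singleLinear (-p) (n - p) n (vLinear (-p) (n - p) n (by lia) z) := by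
  have h := dualTensorCochain_ι (F := F) (M := M) (p := p) (q := n - p) (n := n) (by lia)
    ((dualTensorEquiv hF p (n - p)).symm (vLinear (-p) (n - p) n (by lia) z))
  refine (map_zsmul (dualTensorCochain F M n).hom _ _).trans ((congrArg _ h).trans ?_)
  rw [← Units.smul_def, smul_smul, Int.units_mul_self, one_smul]
  exact congrArg _ ((dualTensorEquiv hF p (n - p)).apply_symm_apply _)

lemma cochainDualTensorAux_ι (hF : IsStrictlyPerfect F) {p q n : ℤ} (h : p + q = n)
    (t : TensorProduct R (Module.Dual R (F.X (-p))) (M.X q)) :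
    cochainDualTensorAux hF p n (dualTensorCochain F M n
      (HomologicalComplex.ιTensorObj (linearDual R F) M p q n h t)) =
    HomologicalComplex.ιTensorObj (linearDual R F) M p q n h t := by
  obtain rfl : q = n - p := by lia
  rw [dualTensorCochain_ι]
  have h1 : vLinear (-p) (n - p) n (by lia) (singleLinear (-p) (n - p) n
      (dualTensorHom R (F.X (-p)) (M.X (n - p)) t)) = dualTensorHom R (F.X (-p)) (M.X (n - p)) t :=
    congrArg ModuleCat.Hom.hom (Cochain.single_v (ModuleCat.ofHom _) n (by lia))
  rw [Units.smul_def, map_zsmul, cochainDualTensorAux_apply, h1, ← Units.smul_def, smul_smul, Int.units_mul_self, one_smul]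
  exact congrArg _ ((dualTensorEquiv hF p (n - p)).symm_apply_apply _)

lemma cochainDualTensorAux_ι_of_ne (hF : IsStrictlyPerfect F) {p p' q n : ℤ} (h : p + q = n)
    (hp : p' ≠ p) (t : TensorProduct R (Module.Dual R (F.X (-p))) (M.X q)) :
    cochainDualTensorAux hF p' n (dualTensorCochain F M n
      (HomologicalComplex.ιTensorObj (linearDual R F) M p q n h t)) = 0 := by
  rw [dualTensorCochain_ι]
  have h1 : vLinear (-p') (n - p') n (by lia) (singleLinear (-p) q n
      (dualTensorHom R (F.X (-p)) (M.X q) t)) = 0 :=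
    congrArg ModuleCat.Hom.hom (Cochain.single_v_eq_zero (ModuleCat.ofHom _) n _ _ (by lia) (by lia))
  rw [Units.smul_def, map_zsmul, cochainDualTensorAux_apply, h1, map_zero]
  refine (congrArg _ (congrArg _ (map_zero (HomologicalComplex.ιTensorObj (linearDual R F) M p'
    (n - p') n (by lia)).hom))).trans ?_
  rw [smul_zero, smul_zero]

lemma dualTensorCochain_surjective (hF : IsStrictlyPerfect F) (n : ℤ) :
    Function.Surjective (dualTensorCochain F M n) := by
  obtain ⟨a, b, hab⟩ := hF.bounded
  intro z
  -- Cochains form a product and the tensor product a direct sum. Only -b ≤ p ≤ -a have F^(-p)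
  -- possibly nonzero, so a finite sum of degreewise inverses suffices.
  refine ⟨∑ p ∈ Finset.Icc (-b) (-a), cochainDualTensorAux hF p n z, ?_⟩
  refine ((map_sum _ _ _).trans
    (Finset.sum_congr rfl fun p _ ↦ dualTensorCochain_aux hF p n z)).trans ?_
  refine Cochain.ext _ _ fun i j hij ↦ ?_
  obtain ⟨p, rfl⟩ : ∃ p, i = -p := ⟨-i, by simp⟩
  obtain rfl : j = n - p := by lia
  apply ModuleCat.hom_ext
  change vLinear (-p) (n - p) n (by lia) _ = vLinear (-p) (n - p) n (by lia) z
  rw [map_sum]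
  have h1 (p' : ℤ) (hp : p' ≠ p) : vLinear (-p) (n - p) n (by lia) (singleLinear (-p') (n - p') n
      (vLinear (-p') (n - p') n (by lia) z)) = 0 :=
    congrArg ModuleCat.Hom.hom (Cochain.single_v_eq_zero (ModuleCat.ofHom _) n _ _ (by lia) (by lia))
  rw [Finset.sum_eq_single p (fun p' _ hp ↦ h1 p' hp) fun hp ↦ ?_]
  · exact congrArg ModuleCat.Hom.hom (Cochain.single_v (ModuleCat.ofHom _) n (by lia))
  · have := hab (-p) (by rw [Finset.mem_Icc] at hp; lia)
    ext x
    rw [Subsingleton.elim x 0, map_zero, map_zero]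

lemma dualTensorCochain_injective (hF : IsStrictlyPerfect F) (n : ℤ) :
    Function.Injective (dualTensorCochain F M n) := by
  obtain ⟨a, b, hab⟩ := hF.bounded
  suffices dualTensorCochain F M n ≫ ModuleCat.ofHom
      (∑ p ∈ Finset.Icc (-b) (-a), cochainDualTensorAux hF p n) = 𝟙 _ from
    Function.LeftInverse.injective (g := ⇑(∑ p ∈ Finset.Icc (-b) (-a), cochainDualTensorAux (M := M) hF p n))
      fun t ↦ congr($(this).hom t)
  apply HomologicalComplex.mapBifunctor.hom_ext
  intro p q hpq
  apply ModuleCat.hom_ext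
  apply LinearMap.ext
  intro t
  change (∑ p ∈ Finset.Icc (-b) (-a), cochainDualTensorAux hF p n) (dualTensorCochain F M n
      (HomologicalComplex.ιTensorObj (linearDual R F) M p q n hpq t)) =
      HomologicalComplex.ιTensorObj (linearDual R F) M p q n hpq t
  rw [LinearMap.sum_apply, Finset.sum_eq_single p
    (fun p' _ hp ↦ cochainDualTensorAux_ι_of_ne hF hpq hp t) fun hp ↦ ?_]
  · exact cochainDualTensorAux_ι hF hpq t
  · have := hab (-p) (by rw [Finset.mem_Icc] at hp; lia)
    have : Subsingleton (Module.Dual R (F.X (-p))) := inferInstance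
    have : Subsingleton (TensorProduct R (Module.Dual R (F.X (-p))) (M.X q)) := inferInstance
    have ht : t = 0 := this.elim _ _
    rw [ht, map_zero, map_zero, map_zero]

lemma isZero_homology_tensorObj_linearDual_iff (hF : IsStrictlyPerfect F) (n : ℤ) :
    IsZero ((HomologicalComplex.tensorObj (linearDual R F) M).homology n) ↔
      ExtVanish (Q.obj F) (Q.obj M) n := by
  have := hF.isKProjective
  rw [extVanish_Q_iff, ← HomologicalComplex.exactAt_iff_isZero_homology,
    HomologicalComplex.exactAt_iff' _ (n - 1) n (n + 1) (by simp) (by simp),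
    ShortComplex.moduleCat_exact_iff]
  refine ⟨fun h z ↦ ?_, fun h t ht ↦ ?_⟩
  · obtain ⟨t, ht⟩ := dualTensorCochain_surjective hF n z.1
    obtain ⟨w, hw⟩ := h t (dualTensorCochain_injective hF (n + 1) (by
      exact (δ_dualTensorCochain rfl t).symm.trans (((congrArg (δ n (n + 1)) ht).trans
        (Cocycle.δ_eq_zero z _)).trans (map_zero (dualTensorCochain F M (n + 1)).hom).symm)))
    refine ⟨dualTensorCochain F M (n - 1) w, ?_⟩
    refine (δ_dualTensorCochain (by simp) w).trans ?_
    exact (congrArg _ hw).trans ht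
  · obtain ⟨w, hw⟩ := h ⟨dualTensorCochain F M n t, (Cocycle.mem_iff n (n + 1) rfl _).2
      ((δ_dualTensorCochain rfl t).trans ((congrArg _ ht).trans (map_zero _)))⟩
    obtain ⟨s, rfl⟩ := dualTensorCochain_surjective hF (n - 1) w
    exact ⟨s, dualTensorCochain_injective hF n
      ((δ_dualTensorCochain (by simp) s).symm.trans hw)⟩

/-- Duality for strictly perfect complexes. -/
lemma extVanish_linearDual_iff (hF : IsStrictlyPerfect F) {n m : ℤ} (hnm : n + m = 0) :
    ExtVanish (Q.obj (linearDual R F)) (Q.obj (charDual M)) m ↔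
      ExtVanish (Q.obj F) (Q.obj M) n := by
  have := hF.linearDual.isKProjective
  rw [← isZero_homology_tensorObj_linearDual_iff hF, isZero_iff_forall_charModule,
    tensorObj_forms_eq_zero_iff hnm]

/-- Biduality, in a degree. -/
def bidualIsoX (hF : IsStrictlyPerfect F) (i : ℤ) :
    F.X i ≅ (linearDual R (linearDual R F)).X i :=
  have := hF.finite
  have := hF.projective
  F.XIsoOfEq (show i = - -i by simp) ≪≫
    -- Dualizing twice negates the differential; the sign (-1)^i compensates.
    (i.negOnePow • (Module.evalEquiv R (F.X (- -i)))).toModuleIso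

lemma bidualIsoX_hom_apply (hF : IsStrictlyPerfect F) (i : ℤ) (x : F.X i)
    (g : (linearDual R F).X (-i)) :
    dualApply ((bidualIsoX hF i).hom x) g = i.negOnePow •
      dualApply g ((F.XIsoOfEq (show i = - -i by simp)).hom x) := rfl

/-- Biduality for strictly perfect complexes. -/
def bidualIso (hF : IsStrictlyPerfect F) : F ≅ linearDual R (linearDual R F) :=
  HomologicalComplex.Hom.isoOfComponents (bidualIsoX hF) fun i j hij ↦ by
    apply ModuleCat.hom_ext
    apply LinearMap.ext
    intro x
    refine LinearMap.ext (f := dualApply _) (g := dualApply _) fun g ↦ ?_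
    change dualApply ((linearDual R (linearDual R F)).d i j ((bidualIsoX hF i).hom x)) g =
      dualApply ((bidualIsoX hF j).hom (F.d i j x)) g
    rw [dualApply_d, bidualIsoX_hom_apply, bidualIsoX_hom_apply, dualApply_d]
    have h : (F.XIsoOfEq (show j = - -j by simp)).hom (F.d i j x) =
      F.d (- -i) (- -j) ((F.XIsoOfEq (show i = - -i by simp)).hom x) := by
      have : F.d i j ≫ (F.XIsoOfEq (show j = - -j by simp)).hom =
        (F.XIsoOfEq (show i = - -i by simp)).hom ≫ F.d (- -i) (- -j) := by simp
      exact congr($(this).hom x)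
    rw [h, smul_smul i.negOnePow, ← Int.negOnePow_add, add_neg_cancel, Int.negOnePow_zero,
      one_smul]

/-- Hom(-, E) is exact for injective E, so exactness in degree -m passes to the dual in degree m. -/
lemma isZero_homology_dualComplex {E : ModuleCat.{u} R} [Injective E] {n m : ℤ} (hnm : n + m = 0)
    (h : IsZero (M.homology n)) : IsZero ((dualComplex E M).homology m) := by
  rw [← HomologicalComplex.exactAt_iff_isZero_homology] at h ⊢
  obtain rfl : n = -m := by lia
  rw [HomologicalComplex.exactAt_iff' _ (-(m + 1)) (-m) (-(m - 1)) (by simp; lia)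
    (by simp; lia)] at h
  rw [HomologicalComplex.exactAt_iff' _ (m - 1) m (m + 1) (by simp) (by simp),
    ShortComplex.moduleCat_exact_iff]
  intro φ hφ
  have hφ' : M.d (-(m + 1)) (-m) ≫ ModuleCat.ofHom (dualApply φ) = 0 := by
    apply ModuleCat.hom_ext
    apply LinearMap.ext
    intro x
    have h1 : dualApply ((dualComplex E M).d m (m + 1) φ) x = 0 :=
      (congrArg (fun ψ ↦ dualApply (E := E) (M := M) (j := m + 1) ψ x) hφ).trans rfl
    exact (smul_eq_zero_iff_eq _).1 ((dualApply_d E M m (m + 1) φ x).symm.trans h1)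
  let ψ : M.X (-(m - 1)) ⟶ E := h.descToInjective (ModuleCat.ofHom (dualApply φ)) hφ'
  refine ⟨(m.negOnePow • ψ.hom : M.X (-(m - 1)) →ₗ[R] E), ?_⟩
  refine LinearMap.ext (f := dualApply (E := E) (M := M) _) (g := dualApply φ) fun x ↦ ?_
  refine (dualApply_d E M (m - 1) m _ x).trans ?_
  change m.negOnePow • m.negOnePow • ψ (M.d (-m) (-(m - 1)) x) = _
  rw [smul_smul, Int.units_mul_self, one_smul]
  exact congr($(h.comp_descToInjective (ModuleCat.ofHom (dualApply φ)) hφ').hom x)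

end StrictlyPerfect

/-! ### Bounded objects of the derived category and their cohomology. -/

section Truncation

variable {C : Type*} [Category* C] [Abelian C]

lemma exists_Q_map_eq {K X : CochainComplex C ℤ} [K.IsKProjective] (f : Q.obj K ⟶ Q.obj X) :
    ∃ φ : K ⟶ X, Q.map φ = f := by
  obtain ⟨g, hg⟩ := (IsKProjective.Qh_map_bijective K _).2
    ((quotientCompQhIso C).hom.app K ≫ f ≫ (quotientCompQhIso C).inv.app X)
  obtain ⟨φ, rfl⟩ := (HomotopyCategory.quotient C (ComplexShape.up ℤ)).map_surjective g
  refine ⟨φ, ?_⟩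
  have h := quotientCompQhIso_hom_naturality (C := C) φ
  rw [← cancel_epi ((quotientCompQhIso C).hom.app K), ← h, hg]
  simp

lemma extVanish_singleFunctor_iff {Z : C} {Y : DerivedCategory C} {b m n : ℤ} (h : m + b = n) :
    ExtVanish ((DerivedCategory.singleFunctor C b).obj Z) Y m ↔
      ExtVanish ((DerivedCategory.singleFunctor C 0).obj Z) Y n :=
  (extVanish_shift_left_iff h).symm.trans
    (extVanish_congr_left (((DerivedCategory.singleFunctors C).shiftIso b 0 b (by simp)).app Z))

open Pretriangulated in
/-- A bounded object has no morphisms to `Y` when its cohomology objects have none. -/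
lemma extVanish_of_homology {Y : DerivedCategory C} {m : ℤ} (k : ℕ) :
    ∀ (X : DerivedCategory C) (b : ℤ) (_ : X.IsLE b) (_ : X.IsGE (b + 1 - k))
      (_ : ∀ l : ℤ, ExtVanish ((DerivedCategory.singleFunctor C 0).obj
        ((homologyFunctor C l).obj X)) Y (m + l)), ExtVanish X Y m := by
  induction k with
  | zero =>
    intro X b h1 h2 _ f
    have h2 : X.IsGE (b + 1) := by simpa using h2
    exact (TStructure.t.isZero X b (b + 1) (by lia)).eq_of_src _ _
  | succ k ih =>
    intro X b h1 h2 h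
    -- Truncation peels off the top degree: A carries the cohomology of X below b, and B is the
    -- degree b cohomology placed in degree b.
    obtain ⟨A, B, hA, hB, f, g, δ, hT⟩ :=
      TStructure.t.exists_triangle X (b - 1) b (by lia)
    have hA : A.IsLE (b - 1) := ⟨hA⟩
    have hB : B.IsGE b := ⟨hB⟩
    have e1 (l : ℤ) (hl : l < b) : IsIso ((homologyFunctor C l).map f) := by
      have := (HomologySequence.mono_homologyMap_mor₁_iff _ hT (l - 1) l (by lia)).2
        ((isZero_of_isGE B b (l - 1) (by lia)).eq_of_src _ _)
      have := (HomologySequence.epi_homologyMap_mor₁_iff _ hT l).2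
        ((isZero_of_isGE B b l (by lia)).eq_of_tgt _ _)
      exact isIso_of_mono_of_epi ((homologyFunctor C l).map (Triangle.mk f g δ).mor₁)
    have e2 (l : ℤ) (hl : b ≤ l) : IsIso ((homologyFunctor C l).map g) := by
      have := (HomologySequence.mono_homologyMap_mor₂_iff _ hT l).2
        ((isZero_of_isLE A (b - 1) l (by lia)).eq_of_src _ _)
      have := (HomologySequence.epi_homologyMap_mor₂_iff _ hT l (l + 1) (by lia)).2
        ((isZero_of_isLE A (b - 1) (l + 1) (by lia)).eq_of_tgt _ _)
      exact isIso_of_mono_of_epi ((homologyFunctor C l).map (Triangle.mk f g δ).mor₂)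
    have hX (l : ℤ) (hl : l < b + 1 - (k + 1 : ℕ)) : IsZero ((homologyFunctor C l).obj X) :=
      isZero_of_isGE X _ l hl
    refine ExtVanish.obj₂ (T := Triangle.mk f g δ) ?_ ?_ hT
    · refine ih A (b - 1) hA ?_ fun l ↦ ?_
      · rw [DerivedCategory.isGE_iff]
        intro l hl
        have := e1 l (by lia)
        exact (hX l (by push_cast; lia)).of_iso (asIso ((homologyFunctor C l).map f))
      · by_cases hl : l < b
        · have := e1 l hl
          exact (h l).congr_left ((DerivedCategory.singleFunctor C 0).mapIso
            (asIso ((homologyFunctor C l).map f)).symm)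
        · intro φ
          exact IsZero.eq_of_src ((DerivedCategory.singleFunctor C 0).map_isZero
            (isZero_of_isLE A (b - 1) l (by lia))) _ _
    · have hB' : B.IsLE b := by
        rw [DerivedCategory.isLE_iff]
        intro l hl
        have := e2 l (by lia)
        exact (isZero_of_isLE X b l hl).of_iso (asIso ((homologyFunctor C l).map g)).symm
      obtain ⟨Z, ⟨e⟩⟩ := exists_iso_singleFunctor_obj_of_isGE_of_isLE B b
      have := e2 b le_rfl
      have eZ : Z ≅ (homologyFunctor C b).obj X :=
        ((singleFunctorCompHomologyFunctorIso C b).app Z).symm ≪≫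
          (homologyFunctor C b).mapIso e.symm ≪≫ (asIso ((homologyFunctor C b).map g)).symm
      refine ExtVanish.congr_left ?_ e.symm
      rw [extVanish_singleFunctor_iff rfl]
      exact (h b).congr_left ((DerivedCategory.singleFunctor C 0).mapIso eZ.symm)

end Truncation

/-! ### Finite resolutions by finitely generated projectives. -/

section Resolutions

variable {R : Type u} [CommRing R]

lemma IsStrictlyPerfect.single (P : ModuleCat.{u} R) [Module.Finite R P] [Module.Projective R P] :
    IsStrictlyPerfect (single P) where
  finite i := by
    by_cases hi : i = 0
    · subst hi
      exact Module.Finite.equiv (HomologicalComplex.singleObjXSelf (ComplexShape.up ℤ) 0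
        P).symm.toLinearEquiv
    · have : Subsingleton ((RestrictedInjDim.single P).X i) := ModuleCat.subsingleton_of_isZero
        (HomologicalComplex.isZero_single_obj_X (ComplexShape.up ℤ) 0 P i hi)
      exact ⟨⟨∅, Subsingleton.elim _ _⟩⟩
  projective i := by
    by_cases hi : i = 0
    · subst hi
      exact Module.Projective.of_equiv (HomologicalComplex.singleObjXSelf (ComplexShape.up ℤ) 0
        P).symm.toLinearEquiv
    · have : Subsingleton ((RestrictedInjDim.single P).X i) := ModuleCat.subsingleton_of_isZero
        (HomologicalComplex.isZero_single_obj_X (ComplexShape.up ℤ) 0 P i hi)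
      exact Module.Projective.of_equiv (M := PUnit) (LinearEquiv.ofSubsingleton _ _)
  bounded := ⟨0, 0, fun i hi ↦ ModuleCat.subsingleton_of_isZero
    (HomologicalComplex.isZero_single_obj_X (ComplexShape.up ℤ) 0 P i (by lia))⟩

/-- The terms of a mapping cone. -/
def mappingConeXEquiv {F G : Cpx R} (φ : F ⟶ G) (i : ℤ) :
    (mappingCone φ).X i ≃ₗ[R] F.X (i + 1) × G.X i :=
  (HomologicalComplex.homotopyCofiber.XIsoBiprod φ i (i + 1) rfl ≪≫
    ModuleCat.biprodIsoProd _ _).toLinearEquiv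

lemma IsStrictlyPerfect.mappingCone {F G : Cpx R} (hF : IsStrictlyPerfect F)
    (hG : IsStrictlyPerfect G) (φ : F ⟶ G) : IsStrictlyPerfect (mappingCone φ) where
  finite i :=
    have := hF.finite (i + 1)
    have := hG.finite i
    Module.Finite.equiv (mappingConeXEquiv φ i).symm
  projective i :=
    have := hF.projective (i + 1)
    have := hG.projective i
    Module.Projective.of_equiv (mappingConeXEquiv φ i).symm
  bounded := by
    obtain ⟨a, b, h⟩ := hF.bounded
    obtain ⟨a', b', h'⟩ := hG.bounded
    refine ⟨min (a - 1) a', max b b', fun i hi ↦ ?_⟩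
    have := h (i + 1) (by grind)
    have := h' i (by grind)
    exact (mappingConeXEquiv φ i).injective.subsingleton

-- T is the cone of K → P for a first syzygy K. The resolution of K given by induction is
-- K-projective, so this derived morphism is represented by a chain map, whose cone is again
-- strictly perfect.
open Pretriangulated in
lemma exists_strictlyPerfect_iso [IsNoetherianRing R] (n : ℕ) : ∀ (T : ModuleCat.{u} R)
    [Module.Finite R T] [HasProjectiveDimensionLE T n],
    ∃ F : Cpx R, IsStrictlyPerfect F ∧
      Nonempty (Q.obj F ≅ (DerivedCategory.singleFunctor (ModuleCat.{u} R) 0).obj T) := by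
  induction n with
  | zero =>
    intro T _ h
    have : Projective T := projective_iff_hasProjectiveDimensionLT_one.2 h
    have : Module.Projective R T := (IsProjective.iff_projective T).2 this
    exact ⟨RestrictedInjDim.single T, IsStrictlyPerfect.single T, ⟨Iso.refl _⟩⟩
  | succ n ih =>
    intro T _ h
    obtain ⟨P, _, _, _, _, f, hf⟩ := Module.exists_finite_presentation R T
    have hS := LinearMap.shortExact_shortComplexKer hf
    have : Module.Finite R f.shortComplexKer.X₁ := inferInstanceAs (Module.Finite R f.ker)
    have : HasProjectiveDimensionLE f.shortComplexKer.X₁ n :=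
      (hS.hasProjectiveDimensionLT_X₃_iff n
        (ModuleCat.projective_of_categoryTheory_projective _)).1 h
    obtain ⟨F, hF, ⟨e⟩⟩ := ih f.shortComplexKer.X₁
    have := hF.isKProjective
    have : Module.Finite R f.shortComplexKer.X₂ := inferInstanceAs (Module.Finite R P)
    have : Module.Projective R f.shortComplexKer.X₂ := inferInstanceAs (Module.Projective R P)
    have hP := IsStrictlyPerfect.single f.shortComplexKer.X₂
    obtain ⟨φ, hφ⟩ := exists_Q_map_eq (K := F) (X := RestrictedInjDim.single f.shortComplexKer.X₂)
      (e.hom ≫ hS.singleTriangle.mor₁)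
    refine ⟨_, hF.mappingCone hP φ, ⟨?_⟩⟩
    exact Triangle.π₃.mapIso (isoTriangleOfIso₁₂ _ _ (mappingCone_triangle_distinguished φ)
      hS.singleTriangle_distinguished e (Iso.refl _) ((Category.comp_id _).trans hφ))

lemma smul_homology_eq_zero {K : Cpx R} {l : ℤ} {r : R}
    (h : ∀ x : K.X l, K.d l (l + 1) x = 0 → ∃ y : K.X (l - 1), K.d (l - 1) l y = r • x)
    (x : K.homology l) : r • x = 0 := by
  obtain ⟨z, rfl⟩ := (ModuleCat.epi_iff_surjective (K.homologyπ l)).1 inferInstance x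
  obtain ⟨y, hy⟩ := h (K.iCycles l z) (congr($(K.iCycles_d l (l + 1)).hom z))
  have : K.toCycles (l - 1) l y = r • z := by
    apply (ModuleCat.mono_iff_injective (K.iCycles l)).1 inferInstance
    rw [map_smul, ← hy]
    exact congr($(K.toCycles_i (l - 1) l).hom y)
  rw [← map_smul, ← this]
  exact congr($(K.toCycles_comp_homologyπ (l - 1) l).hom y)

lemma toSingleMk_smul {F : Cpx R} {E : ModuleCat.{u} R} {p q n : ℤ} (r : R) (f : F.X p ⟶ E)
    (h : p + n = q) : Cochain.toSingleMk (r • f) h = r • Cochain.toSingleMk f h :=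
  (Cochain.toSingleEquiv h).injective (by simp [Cochain.toSingleEquiv]; rfl)

/-- A scalar annihilating the morphisms `F ⟶ E⟦l⟧` annihilates the cohomology of the dual. -/
lemma smul_homology_dualComplex_eq_zero {F : Cpx R} [F.IsKProjective] {E : ModuleCat.{u} R}
    {l : ℤ} {r : R}
    (h : ∀ f : Q.obj F ⟶ ((DerivedCategory.singleFunctor (ModuleCat.{u} R) 0).obj E)⟦l⟧, r • f = 0)
    (x : (dualComplex E F).homology l) : r • x = 0 := by
  refine smul_homology_eq_zero (fun φ hφ ↦ ?_) x
  have hφ' : F.d (-(l + 1)) (-l) ≫ ModuleCat.ofHom (dualApply φ) = 0 := by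
    apply ModuleCat.hom_ext
    apply LinearMap.ext
    intro x
    have h1 : dualApply ((dualComplex E F).d l (l + 1) φ) x = 0 :=
      (congrArg (fun ψ ↦ dualApply (E := E) (M := F) (j := l + 1) ψ x) hφ).trans rfl
    exact (smul_eq_zero_iff_eq _).1 ((dualApply_d E F l (l + 1) φ x).symm.trans h1)
  let z : Cocycle F (RestrictedInjDim.single E) l :=
    Cocycle.toSingleMk (ModuleCat.ofHom (dualApply φ)) (neg_add_cancel l) (-(l + 1)) (by lia) hφ'
  obtain ⟨w, hw⟩ := (derivedClass_eq_zero_iff (r • z)).1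
    ((derivedClass_smul r z).trans (h (derivedClass z)))
  obtain ⟨g, rfl⟩ := Cochain.toSingleMk_surjective w (-(l - 1)) (by lia)
  rw [Cochain.δ_toSingleMk _ _ _ (-l) (by lia)] at hw
  have hw' : l.negOnePow • (F.d (-l) (-(l - 1)) ≫ g) = r • ModuleCat.ofHom (dualApply φ) := by
    apply (Cochain.toSingleEquiv (neg_add_cancel l)).symm.injective
    have h1 : (Cochain.toSingleEquiv (neg_add_cancel l)).symm
      (l.negOnePow • (F.d (-l) (-(l - 1)) ≫ g)) = l.negOnePow • Cochain.toSingleMk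
        (F.d (-l) (-(l - 1)) ≫ g) (neg_add_cancel l) := by
      rw [Units.smul_def, Units.smul_def]
      exact map_zsmul (Cochain.toSingleEquiv (neg_add_cancel l)).symm _ _
    refine h1.trans (hw.trans ?_)
    exact (toSingleMk_smul r _ (neg_add_cancel l)).symm
  refine ⟨(g.hom : F.X (-(l - 1)) →ₗ[R] E), ?_⟩
  refine LinearMap.ext (f := dualApply (E := E) (M := F) _) (g := dualApply (r • φ)) fun x ↦ ?_
  refine (dualApply_d E F (l - 1) l _ x).trans ?_
  exact congr($(hw').hom x)

lemma modExtVanish_single_iff (N Y : ModuleCat.{u} R) (n : ℕ) :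
    ModExtVanish N ((DerivedCategory.singleFunctor (ModuleCat.{u} R) 0).obj Y) n ↔
      Subsingleton (Abelian.Ext N Y n) := by
  refine Iff.trans ?_ Abelian.Ext.homEquiv.subsingleton_congr.symm
  exact ⟨fun h ↦ ⟨fun f g ↦ (h f).trans (h g).symm⟩, fun h f ↦ h.elim _ _⟩

lemma finite_homology [IsNoetherianRing R] {G : Cpx R} {i : ℤ} [Module.Finite R (G.X i)] :
    Module.Finite R (G.homology i) :=
  have : Module.Finite R (G.cycles i) := Module.Finite.of_injective (G.iCycles i).hom
    ((ModuleCat.mono_iff_injective (G.iCycles i)).1 inferInstance)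
  Module.Finite.of_surjective (G.homologyπ i).hom
    ((ModuleCat.epi_iff_surjective (G.homologyπ i)).1 inferInstance)

/-- A strictly perfect complex with cohomology in one degree only is a shift of a module of
finite projective dimension. -/
lemma IsStrictlyPerfect.exists_finProj_iso [IsNoetherianRing R] {G : Cpx R}
    (hG : IsStrictlyPerfect G) {h : ℤ} (hh : ∀ l ≠ h, IsZero (G.homology l)) :
    ∃ T : ModuleCat.{u} R, FinProj T ∧
      Nonempty (Q.obj G ≅ (DerivedCategory.singleFunctor (ModuleCat.{u} R) h).obj T) := by
  have e (i : ℤ) : (homologyFunctor (ModuleCat.{u} R) i).obj (Q.obj G) ≅ G.homology i :=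
    (homologyFunctorFactors (ModuleCat.{u} R) i).app G
  have : (Q.obj G).IsGE h := (DerivedCategory.isGE_iff _ _).2 fun i hi ↦ (hh i (by lia)).of_iso (e i)
  have : (Q.obj G).IsLE h := (DerivedCategory.isLE_iff _ _).2 fun i hi ↦ (hh i (by lia)).of_iso (e i)
  obtain ⟨T, ⟨eT⟩⟩ := exists_iso_singleFunctor_obj_of_isGE_of_isLE (Q.obj G) h
  have eT' : T ≅ G.homology h :=
    ((singleFunctorCompHomologyFunctorIso _ h).app T).symm ≪≫
      (homologyFunctor _ h).mapIso eT.symm ≪≫ e h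
  have := hG.finite h
  have := finite_homology (G := G) (i := h)
  have := hG.isKProjective
  obtain ⟨a, b, hab⟩ := hG.bounded
  -- Ext^i(T, Y) is computed by cochains from G^(h-i) to Y, and this term vanishes once i > h - a.
  refine ⟨T, ⟨Module.Finite.equiv eT'.toLinearEquiv.symm, (h - a).toNat, ?_⟩, ⟨eT⟩⟩
  refine HasProjectiveDimensionLT.mk fun i hi Y ↦ ?_
  suffices Subsingleton (Abelian.Ext T Y i) from fun e ↦ Subsingleton.elim _ _
  refine (modExtVanish_single_iff T Y i).1
    ((extVanish_singleFunctor_iff (sub_add_cancel (i : ℤ) h)).1 ?_)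
  refine ExtVanish.congr_left ?_ eT
  refine (extVanish_Q_iff (X := RestrictedInjDim.single Y)).2 fun z ↦ ⟨0, ?_⟩
  rw [δ_zero]
  obtain ⟨f, hf⟩ := Cochain.toSingleMk_surjective z.1 (h - i) (by lia)
  have := hab (h - i) (by lia)
  rw [(ModuleCat.isZero_of_subsingleton (G.X (h - i))).eq_of_src f 0] at hf
  rw [← hf, Cochain.toSingleMk_zero]

end Resolutions

/-! ### Weakly regular sequences, depth and height. -/

section Grade

open RingTheory.Sequence

variable {R : Type u} [CommRing R]

lemma subsingleton_ext_congr_right {N Y Y' : ModuleCat.{u} R} (e : Y ≅ Y') {n : ℕ}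
    (h : Subsingleton (Abelian.Ext N Y n)) : Subsingleton (Abelian.Ext N Y' n) :=
  (modExtVanish_single_iff _ _ _).1 ((extVanish_congr_right
    ((DerivedCategory.singleFunctor _ 0).mapIso e)).1 ((modExtVanish_single_iff _ _ _).2 h))

/-- Each regular element costs one degree of vanishing in the long exact sequence of Ext(N, -). -/
lemma subsingleton_ext_quotient {N : ModuleCat.{u} R} {n : ℕ} (rs : List R) :
    ∀ (M : ModuleCat.{u} R) (_ : IsWeaklyRegular M rs)
      (_ : ∀ i ≤ n + rs.length, Subsingleton (Abelian.Ext N M i)),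
      ∀ i ≤ n, Subsingleton (Abelian.Ext N
        (ModuleCat.of R (M ⧸ (Ideal.ofList rs • ⊤ : Submodule R M))) i) := by
  induction rs with
  | nil =>
    intro M _ h i hi
    refine subsingleton_ext_congr_right (LinearEquiv.toModuleIso ?_) (h i (by simpa using hi))
    exact (Submodule.quotEquivOfEqBot _ (by simp)).symm
  | cons r rs ih =>
    intro M hM h i hi
    rw [isWeaklyRegular_cons_iff] at hM
    refine subsingleton_ext_congr_right (LinearEquiv.toModuleIso
      (Submodule.quotOfListConsSMulTopEquivQuotSMulTopInner M r rs).symm)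
      (ih (ModuleCat.of R (QuotSMulTop r M)) hM.2 (fun j hj ↦ ?_) i hi)
    have h1 : Subsingleton (Abelian.Ext N (M.smulShortComplex r).X₂ j) := h j (by simp; lia)
    have h2 : Subsingleton (Abelian.Ext N (M.smulShortComplex r).X₁ (j + 1)) :=
      h (j + 1) (by simp; lia)
    refine ⟨fun x y ↦ ?_⟩
    have h3 (x : Abelian.Ext N (ModuleCat.of R (QuotSMulTop r M)) j) : x = 0 := by
      obtain ⟨x', rfl⟩ := Abelian.Ext.covariant_sequence_exact₃ N
        hM.1.smulShortComplex_shortExact x rfl (Subsingleton.elim _ _)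
      rw [Subsingleton.elim x' 0, Abelian.Ext.zero_comp]
      rfl
    rw [h3 x, h3 y]

variable [IsNoetherianRing R]

/-- If no element of `p` is regular modulo a weakly regular sequence, then `p` lies in a prime
ideal that annihilates a nonzero element modulo the sequence. -/
lemma exists_prime_of_not_isWeaklyRegular_append {p : Ideal R} {rs : List R}
    (hp : p ≠ ⊤) (hrsp : ∀ r ∈ rs, r ∈ p) (hrs : IsWeaklyRegular R rs)
    (h : ∀ r ∈ p, ¬ IsWeaklyRegular R (rs ++ [r])) :
    ∃ q : Ideal R, q.IsPrime ∧ p ≤ q ∧ ∃ y : R, ∀ r, r ∈ q ↔ r * y ∈ Ideal.ofList rs := by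
  have hle : Ideal.ofList rs ≤ p := Ideal.span_le.2 hrsp
  have : Nontrivial (R ⧸ (Ideal.ofList rs • ⊤ : Ideal R)) := by
    rw [smul_eq_mul, Ideal.mul_top]
    exact Ideal.Quotient.nontrivial_iff.2 fun h' ↦ hp (top_le_iff.1 (h' ▸ hle))
  have hex : ∃ q ∈ associatedPrimes R (R ⧸ (Ideal.ofList rs • ⊤ : Ideal R)), p ≤ q := by
    rcases associatedPrimes.nonempty R (R ⧸ (Ideal.ofList rs • ⊤ : Ideal R)) with ⟨q₀, -⟩
    -- Prime avoidance: all of p consists of zero divisors modulo the sequence, so p lies in one of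
    -- the finitely many associated primes.
    apply (Ideal.subset_union_prime_finite (associatedPrimes.finite R _) q₀ q₀ _).mp
    · rw [biUnion_associatedPrimes_eq_compl_regular]
      intro r hr hreg
      exact h r hr ((isWeaklyRegular_append_iff _ _ _).2
        ⟨hrs, (isWeaklyRegular_singleton_iff _ _).2 hreg⟩)
    · exact fun I hI _ _ ↦ hI.isPrime
  obtain ⟨q, hq, hpq⟩ := hex
  obtain ⟨hq', x, hx⟩ := isAssociatedPrime_iff.1 hq
  obtain ⟨y, rfl⟩ := Submodule.mkQ_surjective _ x
  refine ⟨q, hq', hpq, y, fun r ↦ ?_⟩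
  rw [hx, Submodule.mem_colon_singleton, ← map_smul, Submodule.mem_bot, Submodule.mkQ_apply,
    Submodule.Quotient.mk_eq_zero, smul_eq_mul, smul_eq_mul, Ideal.mul_top]

lemma IsCohenMacaulay.subsingleton_ext (hR : IsCohenMacaulay R) (p : PrimeSpectrum R) {n : ℕ}
    (hn : n < p.asIdeal.height) :
    Subsingleton (Abelian.Ext (ModuleCat.of (Localization.AtPrime p.asIdeal)
      (Localization.AtPrime p.asIdeal ⧸ IsLocalRing.maximalIdeal (Localization.AtPrime p.asIdeal)))
      (ModuleCat.of (Localization.AtPrime p.asIdeal) (Localization.AtPrime p.asIdeal)) n) := by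
  rw [← modExtVanish_single_iff]
  refine (isZero_derivedHom_homology_iff _ (single _) _).1 ?_
  by_contra hn'
  have h1 : ringDepth (Localization.AtPrime p.asIdeal) ≤ (((n : ℤ) : ℝ) : EReal) :=
    iInf₂_le (n : ℤ) hn'
  obtain ⟨d, hd, hd'⟩ := height_eq p
  rw [hR p, hd', EReal.coe_le_coe_iff] at h1
  rw [hd] at hn
  have h2 : n < d := by exact_mod_cast hn
  have h3 : d ≤ n := by exact_mod_cast h1
  lia

/-- If the height exceeded the length, enough groups Ext^i(k, R_q) would vanish to force Hom(k,
R_q/(rs)) = 0. The class of y defines such a homomorphism, so y would be killed modulo rs by some s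
outside q, against the description of q. -/
lemma IsCohenMacaulay.height_le_length (hR : IsCohenMacaulay R) {q : Ideal R} [q.IsPrime]
    {rs : List R} (hrs : IsWeaklyRegular R rs) {y : R}
    (hy : ∀ r, r ∈ q ↔ r * y ∈ Ideal.ofList rs) : q.height ≤ rs.length := by
  by_contra! hlt
  let A := Localization.AtPrime q
  have hrs' : IsWeaklyRegular A (rs.map (algebraMap R A)) :=
    hrs.of_isLocalization A q.primeCompl
  have h := subsingleton_ext_quotient (n := 0) _ (ModuleCat.of A A) hrs' (fun i hi ↦
    hR.subsingleton_ext ⟨q, inferInstance⟩ (lt_of_le_of_lt (by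
      simp only [zero_add, List.length_map] at hi
      exact_mod_cast hi) hlt)) 0 le_rfl
  set I : Ideal A := Ideal.ofList (rs.map (algebraMap R A)) • ⊤ with hI
  have hI' : I = (Ideal.ofList rs).map (algebraMap R A) := by
    rw [hI, smul_eq_mul, Ideal.mul_top, Ideal.map_ofList]
  let g : A →ₗ[A] A ⧸ I := LinearMap.toSpanSingleton A (A ⧸ I) (I.mkQ (algebraMap R A y))
  have hg : IsLocalRing.maximalIdeal A ≤ LinearMap.ker g := by
    rw [← Localization.AtPrime.map_eq_maximalIdeal, Ideal.map_le_iff_le_comap]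
    intro r hr
    rw [Ideal.mem_comap, LinearMap.mem_ker, LinearMap.toSpanSingleton_apply, ← map_smul,
      Submodule.mkQ_apply, Submodule.Quotient.mk_eq_zero, smul_eq_mul, ← map_mul, hI']
    exact Ideal.mem_map_of_mem _ ((hy r).1 hr)
  have hz : ModuleCat.ofHom (Submodule.liftQ _ g hg) = 0 :=
    (Abelian.Ext.mk₀_bijective _ _).1 (h.elim _ _)
  have h1 : g 1 = 0 := congr($(hz).hom (Submodule.Quotient.mk (1 : A)))
  rw [LinearMap.toSpanSingleton_apply, one_smul, Submodule.mkQ_apply,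
    Submodule.Quotient.mk_eq_zero, hI',
    IsLocalization.algebraMap_mem_map_algebraMap_iff q.primeCompl] at h1
  obtain ⟨s, hs, h1⟩ := h1
  exact hs ((hy s).2 h1)

/-- Over a Cohen–Macaulay ring, a prime ideal of height `h` contains a weakly regular sequence of
length `h`. -/
lemma IsCohenMacaulay.exists_isWeaklyRegular (hR : IsCohenMacaulay R) {p : Ideal R} [p.IsPrime]
    (n : ℕ) (hn : n ≤ p.height) :
    ∃ rs : List R, rs.length = n ∧ (∀ r ∈ rs, r ∈ p) ∧ IsWeaklyRegular R rs := by
  induction n with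
  | zero => exact ⟨[], rfl, by simp, .nil R R⟩
  | succ n ih =>
    obtain ⟨rs, hl, hrsp, hrs⟩ := ih (le_trans (by exact_mod_cast n.le_succ) hn)
    by_contra! hex
    obtain ⟨q, hq, hpq, y, hy⟩ := exists_prime_of_not_isWeaklyRegular_append
      (Ideal.IsPrime.ne_top') hrsp hrs fun r hr h ↦
        hex (rs ++ [r]) (by simp [hl]) (by simpa [or_imp, forall_and] using ⟨hrsp, hr⟩) h
    -- A sequence that cannot be prolonged inside p forces height(p) ≤ height(q) ≤ n.
    have := hn.trans ((Ideal.height_mono hpq).trans (hR.height_le_length hrs hy))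
    rw [hl] at this
    have : n + 1 ≤ n := by exact_mod_cast this
    lia

/-- Over a noetherian local ring, there is a weakly regular sequence in the maximal ideal, of length
at most the Krull dimension, such that the residue field embeds in the quotient. -/
lemma exists_maximal_isWeaklyRegular {A : Type u} [CommRing A] [IsLocalRing A] [IsNoetherianRing A] :
    ∃ rs : List A, rs.length ≤ ringKrullDim A ∧ (∀ r ∈ rs, r ∈ IsLocalRing.maximalIdeal A) ∧
      IsWeaklyRegular A rs ∧ ∃ y : A, ∀ r, r ∈ IsLocalRing.maximalIdeal A ↔
        r * y ∈ Ideal.ofList rs := by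
  have hb (rs : List A) (h1 : ∀ r ∈ rs, r ∈ IsLocalRing.maximalIdeal A)
      (h2 : IsWeaklyRegular A rs) : rs.length ≤ ringKrullDim A := by
    have h3 : IsRegular A rs := .of_isWeaklyRegular_of_mem_maximalIdeal A h1 h2
    rw [← ringKrullDim_add_length_eq_ringKrullDim_of_isRegular rs h3]
    have : Nontrivial (A ⧸ Ideal.ofList rs) := by
      have := h3.2
      rw [smul_eq_mul, Ideal.mul_top] at this
      exact Ideal.Quotient.nontrivial_iff.2 this.symm
    exact le_add_of_nonneg_left ringKrullDim_nonneg_of_nontrivial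
  obtain ⟨d, hd⟩ : ∃ d : ℕ, ringKrullDim A = d := by
    obtain ⟨d, hd⟩ := ENat.ne_top_iff_exists.1
      (Ideal.height_ne_top_of_isPrime (I := IsLocalRing.maximalIdeal A))
    exact ⟨d, by rw [← IsLocalRing.maximalIdeal_height_eq_ringKrullDim, ← hd]; rfl⟩
  -- If no sequence is terminal, sequences in the maximal ideal can be prolonged to length d + 1,
  -- beyond the bound `hb`.
  by_contra! hex
  have key (n : ℕ) : ∃ rs : List A, rs.length = n ∧
      (∀ r ∈ rs, r ∈ IsLocalRing.maximalIdeal A) ∧ IsWeaklyRegular A rs := by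
    induction n with
    | zero => exact ⟨[], rfl, by simp, .nil A A⟩
    | succ n ih =>
      obtain ⟨rs, hl, hrsp, hrs⟩ := ih
      by_contra! hex'
      obtain ⟨q, hq, hpq, y, hy⟩ := exists_prime_of_not_isWeaklyRegular_append
        (Ideal.IsPrime.ne_top') hrsp hrs fun r hr h ↦
          hex' (rs ++ [r]) (by simp [hl]) (by simpa [or_imp, forall_and] using ⟨hrsp, hr⟩) h
      obtain rfl := (IsLocalRing.maximalIdeal.isMaximal A).eq_of_le hq.ne_top hpq
      obtain ⟨r, h⟩ := hex rs (hb rs hrsp hrs) hrsp hrs y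
      grind
  obtain ⟨rs, hl, h1, h2⟩ := key (d + 1)
  have := hb rs h1 h2
  rw [hd, hl] at this
  have : d + 1 ≤ d := by exact_mod_cast this
  lia

end Grade

/-! ### Finite projective dimension over a noetherian local ring is at most the Krull dimension. -/

section ProjectiveDimension

variable {R : Type u} [CommRing R]

/-- The short exact sequence of character modules. -/
def charShortComplex (S : ShortComplex (ModuleCat.{u} R)) : ShortComplex (ModuleCat.{u} R) :=
  ShortComplex.mk (X₁ := charModule R S.X₃) (X₂ := charModule R S.X₂) (X₃ := charModule R S.X₁)
    (ModuleCat.ofHom (CharacterModule.dual S.g.hom))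
    (ModuleCat.ofHom (CharacterModule.dual S.f.hom)) (by
      refine ModuleCat.hom_ext ((CharacterModule.dual_comp S.f.hom S.g.hom).symm.trans ?_)
      rw [← ModuleCat.hom_comp, S.zero]
      exact CharacterModule.dual_zero)

lemma shortExact_charShortComplex {S : ShortComplex (ModuleCat.{u} R)} (hS : S.ShortExact) :
    (charShortComplex S).ShortExact := by
  have := hS.mono_f
  have := hS.epi_g
  refine {
    exact := (ShortComplex.ShortExact.moduleCat_exact_iff_function_exact _).2
      fun (φ : CharacterModule S.X₂) ↦ ⟨fun hφ ↦ ?_, ?_⟩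
    mono_f := (ModuleCat.mono_iff_injective _).2
      (CharacterModule.dual_injective_of_surjective _ ((ModuleCat.epi_iff_surjective _).1 ‹_›))
    epi_g := (ModuleCat.epi_iff_surjective _).2
      (CharacterModule.dual_surjective_of_injective _ ((ModuleCat.mono_iff_injective _).1 ‹_›)) }
  · refine ⟨S.g.hom.toAddMonoidHom.liftOfSurjective ((ModuleCat.epi_iff_surjective _).1 ‹_›)
      ⟨φ, fun x hx ↦ ?_⟩, ?_⟩
    · obtain ⟨y, rfl⟩ := ((ShortComplex.ShortExact.moduleCat_exact_iff_function_exact _).1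
        hS.exact x).1 hx
      exact congr((show CharacterModule S.X₁ from $hφ) y)
    · exact AddMonoidHom.liftOfRightInverse_comp _ _ _ _
  · rintro ⟨ψ, rfl⟩
    exact congr($((charShortComplex S).zero).hom ψ)

/-- Character duals of projectives are injective, so dualizing a projective resolution of T gives an
injective resolution of its character module. -/
lemma hasInjectiveDimensionLT_charModule (n : ℕ) : ∀ (T : ModuleCat.{u} R)
    [HasProjectiveDimensionLE T n], HasInjectiveDimensionLT (charModule R T) (n + 1) := by
  induction n with
  | zero =>
    intro T h
    have : Projective T := projective_iff_hasProjectiveDimensionLT_one.2 h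
    have : Module.Projective R T := (IsProjective.iff_projective T).2 this
    infer_instance
  | succ n ih =>
    intro T h
    have hS := T.shortExact_projectiveShortComplex
    have : Projective T.projectiveShortComplex.X₂ :=
      ModuleCat.projective_of_categoryTheory_projective _
    have := (hS.hasProjectiveDimensionLT_X₃_iff n this).1 h
    have : Module.Projective R T.projectiveShortComplex.X₂ :=
      (IsProjective.iff_projective _).2 ‹_›
    have := ih T.projectiveShortComplex.X₁
    exact (shortExact_charShortComplex hS).hasInjectiveDimensionLT_X₁ (n + 1) this
      (inferInstanceAs (HasInjectiveDimensionLT (charModule R T.projectiveShortComplex.X₂) (n + 2)))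

lemma uncurry_lTensor {A B B' : Type*} [AddCommGroup A] [Module R A] [AddCommGroup B] [Module R B]
    [AddCommGroup B'] [Module R B'] {c : CharacterModule (TensorProduct R A B)}
    (ψ : A →ₗ[R] CharacterModule B') (i : B →ₗ[R] B')
    (h : ∀ a b, ψ a (i b) = c (TensorProduct.tmul R a b)) (z : TensorProduct R A B) :
    CharacterModule.uncurry ψ (LinearMap.lTensor A i z) = c z := by
  induction z with
  | zero => simp only [map_zero]
  | add x y hx hy => rw [map_add, map_add, map_add, hx, hy]
  | tmul a b => exact h a b

-- Ext^(n+1)(k, T^∨) is the dual of Tor_(n+1)(k, T). Passing to syzygies reduces to n = 0, where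
-- vanishing says that the syzygy K → P stays injective modulo the maximal ideal. Then K → P splits
-- and T is a summand of P.
open IsLocalRing in
lemma hasProjectiveDimensionLE_of_subsingleton_ext [IsLocalRing R] [IsNoetherianRing R] (n : ℕ) :
    ∀ (T : ModuleCat.{u} R) [Module.Finite R T] [HasProjectiveDimensionLE T (n + 1)]
      (_ : Subsingleton (Abelian.Ext (ModuleCat.of R (R ⧸ maximalIdeal R)) (charModule R T) (n + 1))),
      HasProjectiveDimensionLE T n := by
  induction n with
  | zero =>
    intro T _ _ h
    obtain ⟨P, _, _, _, _, f, hf⟩ := Module.exists_finite_presentation R T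
    have hS := LinearMap.shortExact_shortComplexKer hf
    have : Module.Finite R f.shortComplexKer.X₁ := inferInstanceAs (Module.Finite R f.ker)
    have hP := ModuleCat.projective_of_categoryTheory_projective f.shortComplexKer.X₂
    have hK : HasProjectiveDimensionLE f.shortComplexKer.X₁ 0 :=
      (hS.hasProjectiveDimensionLT_X₃_iff 0 hP).1 ‹_›
    have hinj : Function.Injective (LinearMap.lTensor (ResidueField R) f.ker.subtype) := by
      rw [← LinearMap.ker_eq_bot, LinearMap.ker_eq_bot']
      intro z hz
      refine CharacterModule.eq_zero_of_character_apply fun c ↦ ?_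
      -- A character of k ⊗ K is a map k → K^∨. It lifts to k → P^∨ as Ext^1(k, T^∨) = 0, so it
      -- kills the kernel of k ⊗ K → k ⊗ P.
      let φ : ModuleCat.of R (R ⧸ maximalIdeal R) ⟶ (charShortComplex f.shortComplexKer).X₃ :=
        ModuleCat.ofHom (CharacterModule.curry c)
      obtain ⟨ψ, hψ⟩ := Abelian.Ext.covariant_sequence_exact₃ _ (shortExact_charShortComplex hS)
        (Abelian.Ext.mk₀ φ) (zero_add 1) (h.elim _ _)
      obtain ⟨ψ, rfl⟩ := (Abelian.Ext.mk₀_bijective _ _).2 ψ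
      rw [Abelian.Ext.mk₀_comp_mk₀, (Abelian.Ext.mk₀_bijective _ _).1.eq_iff] at hψ
      refine (uncurry_lTensor (ψ.hom : R ⧸ maximalIdeal R →ₗ[R] CharacterModule P) f.ker.subtype
        (fun a b ↦ congr((show CharacterModule f.ker from $(hψ).hom a) b)) z).symm.trans ?_
      exact (congrArg _ hz).trans (map_zero _)
    obtain ⟨l, hl⟩ := (split_injective_iff_lTensor_residueField_injective _).2 hinj
    have hs : f.shortComplexKer.Splitting := ShortComplex.Splitting.ofExactOfRetraction _ hS.exact
      (ModuleCat.ofHom l) (ModuleCat.hom_ext hl) hS.epi_g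
    have : Projective T := (Retract.mk hs.s f.shortComplexKer.g hs.s_g).projective
    exact projective_iff_hasProjectiveDimensionLT_one.1 this
  | succ n ih =>
    intro T _ _ h
    obtain ⟨P, _, _, _, _, f, hf⟩ := Module.exists_finite_presentation R T
    have hS := LinearMap.shortExact_shortComplexKer hf
    have : Module.Finite R f.shortComplexKer.X₁ := inferInstanceAs (Module.Finite R f.ker)
    have : Module.Free R f.shortComplexKer.X₂ := inferInstanceAs (Module.Free R P)
    have hP := ModuleCat.projective_of_categoryTheory_projective f.shortComplexKer.X₂
    have hK : HasProjectiveDimensionLE f.shortComplexKer.X₁ (n + 1) :=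
      (hS.hasProjectiveDimensionLT_X₃_iff (n + 1) hP).1 ‹_›
    refine (hS.hasProjectiveDimensionLT_X₃_iff n hP).2 (ih _ ?_)
    have h2 : Subsingleton (Abelian.Ext (ModuleCat.of R (R ⧸ maximalIdeal R))
      (charShortComplex f.shortComplexKer).X₂ (n + 1)) :=
      HasInjectiveDimensionLT.subsingleton (charModule R f.shortComplexKer.X₂) 1 (n + 1) (by lia) _
    have h3 (x : Abelian.Ext (ModuleCat.of R (R ⧸ maximalIdeal R))
        (charShortComplex f.shortComplexKer).X₃ (n + 1)) : x = 0 := by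
      obtain ⟨x', rfl⟩ := Abelian.Ext.covariant_sequence_exact₃ _
        (shortExact_charShortComplex hS) x rfl (h.elim _ _)
      rw [Subsingleton.elim x' 0, Abelian.Ext.zero_comp]
    exact ⟨fun x y ↦ (h3 x).trans (h3 y).symm⟩

open IsLocalRing in
/-- Over a noetherian local ring, finite projective dimensions are at most the Krull dimension. -/
lemma hasProjectiveDimensionLE_of_isLocalRing [IsLocalRing R] [IsNoetherianRing R] {d : ℕ}
    (hd : ringKrullDim R = d) {T : ModuleCat.{u} R} [Module.Finite R T] (n : ℕ)
    (hT : HasProjectiveDimensionLE T n) : HasProjectiveDimensionLE T d := by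
  induction n with
  | zero => exact hasProjectiveDimensionLT_of_ge T 1 (d + 1) (by lia)
  | succ n ih =>
    by_cases hn : n + 1 ≤ d
    · exact hasProjectiveDimensionLT_of_ge T (n + 1 + 1) (d + 1) (by lia)
    -- Here n ≥ d. Embed k in R/I with I generated by a maximal regular sequence, so that pd R/I ≤ d
    -- ≤ n. Then Ext^(n+1)(k, T^∨) lies between Ext^(n+1)(R/I, T^∨) = 0 and Ext^(n+2) of the
    -- cokernel, zero since T^∨ has injective dimension ≤ n + 1.
    · refine ih (hasProjectiveDimensionLE_of_subsingleton_ext n T ?_)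
      obtain ⟨rs, hl, hrs, hreg, y, hy⟩ := exists_maximal_isWeaklyRegular (A := R)
      have hl : rs.length ≤ d := by
        rw [hd] at hl
        exact_mod_cast hl
      let I : Ideal R := Ideal.ofList rs • ⊤
      have hI : I = Ideal.ofList rs := by
        change Ideal.ofList rs • (⊤ : Ideal R) = _
        rw [smul_eq_mul, Ideal.mul_top]
      have hpd : HasProjectiveDimensionLE (ModuleCat.of R (R ⧸ I)) n := by
        have := ModuleCat.projectiveDimension_quotient_eq_add_length_of_isWeaklyRegular
          (ModuleCat.of R R) rs hreg hrs
        refine (projectiveDimension_le_iff _ _).1 (this.le.trans ?_)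
        rw [ModuleCat.projectiveDimension_eq_zero_of_projective, zero_add]
        exact_mod_cast (show rs.length ≤ n by lia)
      let g : R →ₗ[R] R ⧸ I := LinearMap.toSpanSingleton R (R ⧸ I) (I.mkQ y)
      have hg : LinearMap.ker g = maximalIdeal R := by
        ext r
        rw [LinearMap.mem_ker, LinearMap.toSpanSingleton_apply, ← map_smul,
          Submodule.mkQ_apply, Submodule.Quotient.mk_eq_zero, smul_eq_mul, hI, hy]
      let j : (R ⧸ maximalIdeal R) →ₗ[R] R ⧸ I := Submodule.liftQ _ g hg.ge
      have hj : Function.Injective j := by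
        rw [← LinearMap.ker_eq_bot, Submodule.ker_liftQ_eq_bot _ _ _ hg.le]
      let S : ShortComplex (ModuleCat.{u} R) := ShortComplex.mk (ModuleCat.ofHom j)
        (ModuleCat.ofHom (LinearMap.range j).mkQ) (by
          refine ModuleCat.hom_ext (LinearMap.ext fun x ↦ ?_)
          exact (Submodule.Quotient.mk_eq_zero _).2 ⟨_, rfl⟩)
      have hS : S.ShortExact := {
        exact := (ShortComplex.ShortExact.moduleCat_exact_iff_function_exact _).2
          (LinearMap.exact_map_mkQ_range j)
        mono_f := (ModuleCat.mono_iff_injective _).2 hj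
        epi_g := (ModuleCat.epi_iff_surjective _).2 (Submodule.mkQ_surjective _) }
      have h2 : Subsingleton (Abelian.Ext S.X₂ (charModule R T) (n + 1)) :=
        HasProjectiveDimensionLT.subsingleton (ModuleCat.of R (R ⧸ I)) (n + 1) (n + 1) le_rfl _
      have := hasInjectiveDimensionLT_charModule (n + 1) T
      have h3 : Subsingleton (Abelian.Ext S.X₃ (charModule R T) (1 + (n + 1))) :=
        HasInjectiveDimensionLT.subsingleton (charModule R T) (n + 1 + 1) _ (by lia) _
      have h1 (x : Abelian.Ext S.X₁ (charModule R T) (n + 1)) : x = 0 := by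
        obtain ⟨x', rfl⟩ := Abelian.Ext.contravariant_sequence_exact₁ hS _ x rfl (h3.elim _ _)
        rw [Subsingleton.elim x' 0, Abelian.Ext.comp_zero]
      exact ⟨fun x y ↦ (h1 x).trans (h1 y).symm⟩

end ProjectiveDimension

/-! ### Support of the cohomology of dual complexes. -/

section Support

variable {R : Type u} [CommRing R]

lemma smul_eq_zero_of_shift {A Y : DerivedCategory (ModuleCat.{u} R)} {s : R} {m n k : ℤ}
    (hk : m + k = n) (h : ∀ f : A ⟶ Y⟦m⟧, s • f = 0) (g : A⟦k⟧ ⟶ Y⟦n⟧) : s • g = 0 := by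
  let e : (Y⟦m⟧)⟦k⟧ ≅ Y⟦n⟧ :=
    ((CategoryTheory.shiftFunctorAdd' (DerivedCategory (ModuleCat.{u} R)) m k n hk).app Y).symm
  obtain ⟨f, hf⟩ := (CategoryTheory.shiftFunctor (DerivedCategory (ModuleCat.{u} R)) k).map_surjective
    (g ≫ e.inv)
  rw [← cancel_mono e.inv, Linear.smul_comp, ← hf, ← Functor.map_smul, h f, Functor.map_zero,
    zero_comp]

/-- If the localization of `T` at `q` is projective, then a surjection onto `T` is split up to
multiplication by an element outside `q`. -/
lemma exists_comp_eq_smul_id (q : Ideal R) [q.IsPrime] {P T : ModuleCat.{u} R}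
    [Module.FinitePresentation R T] (f : P ⟶ T) (hf : Function.Surjective f)
    [Projective (T.localizedModule q.primeCompl)] :
    ∃ s ∉ q, ∃ g : T ⟶ P, g ≫ f = s • 𝟙 T := by
  have : Projective ((ModuleCat.localizedModuleFunctor.{u} (R := R) q.primeCompl).obj T) :=
    inferInstanceAs (Projective (T.localizedModule q.primeCompl))
  have : Epi f := (ModuleCat.epi_iff_surjective f).2 hf
  let F := ModuleCat.localizedModuleFunctor.{u} (R := R) q.primeCompl
  have hF : Epi (F.map f) := inferInstance
  obtain ⟨σ, hσ⟩ : ∃ σ : T.localizedModule q.primeCompl ⟶ P.localizedModule q.primeCompl,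
      σ ≫ ModuleCat.localizedModuleMap q.primeCompl f = 𝟙 _ :=
    have := Projective.factorThru_comp (𝟙 (F.obj T)) (F.map f)
    ⟨_, this⟩
  -- Here s clears the denominators of the section σ, and t below turns an equality after
  -- localization into one over R.
  obtain ⟨h, s, hs⟩ := Module.FinitePresentation.exists_lift_of_isLocalizedModule q.primeCompl
    (P.localizedModuleMkLinearMap q.primeCompl)
    ((σ.hom.restrictScalars R).comp (T.localizedModuleMkLinearMap q.primeCompl))
  obtain ⟨t, ht⟩ := Module.Finite.exists_smul_of_comp_eq_of_isLocalizedModule q.primeCompl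
    (T.localizedModuleMkLinearMap q.primeCompl) (f.hom.comp h) (s • LinearMap.id) (by
      ext x
      have h1 : P.localizedModuleMkLinearMap q.primeCompl (h x) =
        s • σ (T.localizedModuleMkLinearMap q.primeCompl x) := congr($hs x)
      have h2 : ModuleCat.localizedModuleMap q.primeCompl f (P.localizedModuleMkLinearMap q.primeCompl (h x)) =
        T.localizedModuleMkLinearMap q.primeCompl (f (h x)) :=
        IsLocalizedModule.map_apply q.primeCompl (P.localizedModuleMkLinearMap q.primeCompl)
          (T.localizedModuleMkLinearMap q.primeCompl) f.hom (h x)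
      refine h2.symm.trans ((congrArg _ h1).trans ?_)
      refine (LinearMap.map_smul ((ModuleCat.localizedModuleMap q.primeCompl f).hom.restrictScalars R) (s : R) _).trans ?_
      refine Eq.trans ?_ (LinearMap.map_smul (T.localizedModuleMkLinearMap q.primeCompl)
        (s : R) x).symm
      exact congrArg _ congr($(hσ).hom (T.localizedModuleMkLinearMap q.primeCompl x)))
  refine ⟨t * s, (t * s).2, ModuleCat.ofHom ((t : R) • h), ?_⟩
  refine ModuleCat.hom_ext (LinearMap.ext fun x ↦ ?_)
  refine (map_smul f.hom (t : R) (h x)).trans ?_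
  refine Eq.trans congr($ht x) ?_
  exact smul_smul (t : R) (s : R) x

/-- The point is that s depends neither on Y nor on n. Once an l-th syzygy is projective at q, a
multiple s • 𝟙 of its identity factors through a projective; connecting maps carry this annihilator
back to T. -/
lemma exists_forall_smul_eq_zero [IsNoetherianRing R] (q : Ideal R) [q.IsPrime] (l : ℕ) :
    ∀ (T : ModuleCat.{u} R) [Module.Finite R T]
      [HasProjectiveDimensionLE (T.localizedModule q.primeCompl) l],
      ∃ s ∉ q, ∀ (Y : ModuleCat.{u} R) (n : ℕ) (_ : l < n)
        (f : (DerivedCategory.singleFunctor (ModuleCat.{u} R) 0).obj T ⟶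
          ((DerivedCategory.singleFunctor (ModuleCat.{u} R) 0).obj Y)⟦(n : ℤ)⟧), s • f = 0 := by
  have hproj (P : ModuleCat.{u} R) [Projective P] (Y : ModuleCat.{u} R) (n : ℕ) (hn : 1 ≤ n) :
      ModExtVanish P ((DerivedCategory.singleFunctor (ModuleCat.{u} R) 0).obj Y) n :=
    (modExtVanish_single_iff _ _ _).2 (HasProjectiveDimensionLT.subsingleton P 1 n hn Y)
  induction l with
  | zero =>
    intro T _ h
    obtain ⟨P, _, _, _, _, f, hf⟩ := Module.exists_finite_presentation R T
    have hP : Projective f.shortComplexKer.X₂ := ModuleCat.projective_of_categoryTheory_projective _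
    have : Projective (T.localizedModule q.primeCompl) :=
      projective_iff_hasProjectiveDimensionLT_one.2 h
    have := Module.finitePresentation_of_finite R T
    obtain ⟨s, hs, g, hg⟩ := exists_comp_eq_smul_id q f.shortComplexKer.g hf
    refine ⟨s, hs, fun Y n hn φ ↦ ?_⟩
    have h1 : s • φ = (DerivedCategory.singleFunctor (ModuleCat.{u} R) 0).map (s • 𝟙 _) ≫ φ := by
      rw [Functor.map_smul, CategoryTheory.Functor.map_id, Linear.smul_comp, Category.id_comp]
    rw [h1, ← hg, Functor.map_comp, Category.assoc, hproj _ Y n hn (_ ≫ φ), comp_zero]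
  | succ l ih =>
    intro T _ h
    obtain ⟨P, _, _, _, _, f, hf⟩ := Module.exists_finite_presentation R T
    have hP : Projective f.shortComplexKer.X₂ := ModuleCat.projective_of_categoryTheory_projective _
    have hS := LinearMap.shortExact_shortComplexKer hf
    have : Module.Finite R f.shortComplexKer.X₁ := inferInstanceAs (Module.Finite R f.ker)
    let F := ModuleCat.localizedModuleFunctor.{u} (R := R) q.primeCompl
    have : HasProjectiveDimensionLE (f.shortComplexKer.X₁.localizedModule q.primeCompl) l :=
      ((hS.map_of_exact F).hasProjectiveDimensionLT_X₃_iff l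
        (F.projective_obj_of_projective hP)).1 h
    obtain ⟨s, hs, H⟩ := ih f.shortComplexKer.X₁
    refine ⟨s, hs, fun Y n hn φ ↦ ?_⟩
    obtain ⟨n, rfl⟩ : ∃ m, n = m + 1 := ⟨n - 1, by lia⟩
    obtain ⟨g, rfl⟩ := (hproj f.shortComplexKer.X₂ Y (n + 1) (by lia)).exists_eq_mor₃_comp
      hS.singleTriangle_distinguished φ
    refine (Linear.comp_smul _ _ _ hS.singleTriangle.mor₃ s g).symm.trans ?_
    exact (congrArg (hS.singleTriangle.mor₃ ≫ ·)
      (smul_eq_zero_of_shift (by push_cast; rfl) (H Y n (by lia)) g)).trans comp_zero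

/-- The cohomology of the dual of a perfect complex resolving a module is supported at primes of
height at least the degree. -/
lemma le_height_of_mem_support_homology_linearDual [IsNoetherianRing R] {T : ModuleCat.{u} R}
    (hT : FinProj T) {F : Cpx R} (hF : IsStrictlyPerfect F)
    (e : Q.obj F ≅ (DerivedCategory.singleFunctor (ModuleCat.{u} R) 0).obj T)
    {q : PrimeSpectrum R} {l : ℤ} (hq : q ∈ Module.support R ((linearDual R F).homology l)) {d : ℕ}
    (hd : q.asIdeal.height = d) : l ≤ d := by
  by_contra! hl
  obtain ⟨hT, N, hN⟩ := hT
  have := hF.isKProjective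
  let A := Localization.AtPrime q.asIdeal
  have hdA : ringKrullDim A = d := by
    rw [IsLocalization.AtPrime.ringKrullDim_eq_height q.asIdeal, hd]
    rfl
  have : Module.Finite A (T.localizedModule q.asIdeal.primeCompl) :=
    Module.Finite.of_isLocalizedModule q.asIdeal.primeCompl
      (T.localizedModuleMkLinearMap q.asIdeal.primeCompl)
  have : HasProjectiveDimensionLE (T.localizedModule q.asIdeal.primeCompl) d :=
    hasProjectiveDimensionLE_of_isLocalRing (R := A) hdA N
      (ModuleCat.localizedModule_hasProjectiveDimensionLE N _ T)
  -- Since pd T_q ≤ d < l, some s outside q annihilates Ext^l(T, R), while q contains the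
  -- annihilator of every finite module it supports.
  obtain ⟨s, hs, H⟩ := exists_forall_smul_eq_zero q.asIdeal d T
  obtain ⟨n, rfl⟩ := Int.eq_ofNat_of_zero_le (show 0 ≤ l by lia)
  have := hF.linearDual.finite n
  have := finite_homology (G := linearDual R F) (i := n)
  rw [Module.mem_support_iff_of_finite] at hq
  refine hs (hq (Module.mem_annihilator.2 (smul_homology_dualComplex_eq_zero fun f ↦ ?_)))
  rw [← cancel_epi e.inv, comp_zero, Linear.comp_smul]
  exact H _ n (by lia) _

end Support

/-! ### The two inequalities between rid and the width supremum. -/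

section RestrictedInjectiveDimension

variable {R : Type u} [CommRing R]

lemma modExtVanish_of_isGE (N : ModuleCat.{u} R) {Y : DerivedCategory (ModuleCat.{u} R)} {a n : ℤ}
    (hY : Y.IsGE a) (hn : n < a) : ModExtVanish N Y n := fun f ↦
  have : TStructure.t.IsGE (Y⟦n⟧) (a - n) := TStructure.t.isGE_shift Y a n (a - n)
  TStructure.t.zero f 0 (a - n)

lemma isGE_charDual {M : Cpx R} {b : ℤ} (hM : ∀ n : ℤ, ¬ IsZero (M.homology n) → n ≤ b) :
    (Q.obj (charDual M)).IsGE (-b) := by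
  refine (DerivedCategory.isGE_iff _ _).2 fun i hi ↦ ?_
  refine IsZero.of_iso (isZero_homology_dualComplex (M := M) (neg_add_cancel i) ?_)
    ((homologyFunctorFactors (ModuleCat.{u} R) i).app _)
  by_contra h
  have := hM _ h
  lia

lemma projectiveDimension_quotient_of_isWeaklyRegular (rs : List R) :
    ∀ (M : ModuleCat.{u} R) (n : ℕ) (_ : HasProjectiveDimensionLE M n)
      (_ : RingTheory.Sequence.IsWeaklyRegular M rs),
      HasProjectiveDimensionLE
        (ModuleCat.of R (M ⧸ (Ideal.ofList rs • ⊤ : Submodule R M))) (n + rs.length) := by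
  induction rs with
  | nil =>
    intro M n h _
    exact hasProjectiveDimensionLT_of_iso (LinearEquiv.toModuleIso
      (Submodule.quotEquivOfEqBot _ (by simp)).symm) (n + 1)
  | cons r rs ih =>
    intro M n h hM
    rw [RingTheory.Sequence.isWeaklyRegular_cons_iff] at hM
    have h1 : HasProjectiveDimensionLE (ModuleCat.of R (QuotSMulTop r M)) (n + 1) :=
      hM.1.smulShortComplex_shortExact.hasProjectiveDimensionLT_X₃ (n + 1) h
        (hasProjectiveDimensionLT_of_ge M (n + 1) (n + 2) (by lia))
    have h2 := ih _ _ h1 hM.2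
    have h3 := hasProjectiveDimensionLT_of_iso (LinearEquiv.toModuleIso
      (Submodule.quotOfListConsSMulTopEquivQuotSMulTopInner M r rs).symm) (n + 1 + rs.length + 1)
    rw [List.length_cons, show n + (rs.length + 1) = n + 1 + rs.length by lia]
    exact h3

lemma isZero_homology_linearDual {F : Cpx R} [F.IsKProjective] {l : ℤ}
    (h : ExtVanish (Q.obj F)
      ((DerivedCategory.singleFunctor (ModuleCat.{u} R) 0).obj (ModuleCat.of R R)) l) :
    IsZero ((linearDual R F).homology l) := by
  rw [ModuleCat.isZero_iff_subsingleton]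
  refine subsingleton_of_forall_eq 0 fun x ↦ ?_
  rw [← one_smul R x]
  exact smul_homology_dualComplex_eq_zero (fun f ↦ by rw [h f, smul_zero]) x

lemma mem_rid {M : Cpx R} {T : ModuleCat.{u} R} (hT : FinProj T) {i : ℤ}
    (h : ¬ ModExtVanish T (Q.obj M) i) : ((i : ℝ) : EReal) ≤ rid M :=
  le_iSup₂_of_le i ⟨T, hT, fun h' ↦ h ((isZero_derivedHom_homology_iff _ _ _).1 h')⟩ le_rfl

variable [IsNoetherianRing R]

/-- If `R/p` has nonvanishing `Ext` to a bounded below object, so has any `R/I` with `I ≤ p`, in the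
same or a smaller degree. -/
lemma exists_not_modExtVanish_quotient {Y : DerivedCategory (ModuleCat.{u} R)} {b : ℤ}
    (hY : Y.IsGE (-b)) {I : Ideal R} {p : PrimeSpectrum R} (hI : I ≤ p.asIdeal) {n : ℤ}
    (hp : ¬ ModExtVanish (ModuleCat.of R (R ⧸ p.asIdeal)) Y (-n)) :
    ∃ j ≥ n, ¬ ModExtVanish (ModuleCat.of R (R ⧸ I)) Y (-j) := by
  by_contra! h
  -- Descending induction on j from above b, where boundedness of Y gives vanishing. The kernel of
  -- R/I → R/q is supported on primes containing I, so the case j + 1 applies to it.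
  suffices H : ∀ (k : ℕ) (j : ℤ) (_ : n ≤ j) (_ : b < j + k) (q : PrimeSpectrum R)
      (_ : I ≤ q.asIdeal), ModExtVanish (ModuleCat.of R (R ⧸ q.asIdeal)) Y (-j) from
    hp (H (b + 1 - n).toNat n le_rfl (by lia) p hI)
  intro k
  induction k with
  | zero => exact fun j _ hb q _ ↦ modExtVanish_of_isGE _ hY (by simp at hb; lia)
  | succ k ih =>
    intro j hj hb q hq
    let f : (R ⧸ I) →ₗ[R] R ⧸ q.asIdeal := Submodule.factor hq
    have hf : Function.Surjective f := Submodule.factor_surjective hq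
    have hS := LinearMap.shortExact_shortComplexKer hf
    have h1 : ModExtVanish (ModuleCat.of R f.ker) Y (-(j + 1)) := by
      refine modExtVanish_of_support _ fun q' hq' ↦
        ih (j + 1) (by lia) (by push_cast at hb; lia) q' ?_
      refine le_trans (fun r hr ↦ Module.mem_annihilator.2 fun x ↦ Subtype.ext ?_)
        (Module.mem_support_iff_of_finite.1 hq')
      obtain ⟨y, hy⟩ := Ideal.Quotient.mk_surjective (x : R ⧸ I)
      rw [Submodule.coe_smul, ← hy]
      exact Ideal.Quotient.eq_zero_iff_mem.2 (I.mul_mem_right y hr)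
    have h2 := ModExtVanish.X₃ hS h1 ((show -(j + 1) + 1 = -j by lia) ▸ h j hj)
    rwa [show -(j + 1) + 1 = -j by lia] at h2

open RingTheory.Sequence in
/-- The dual of a resolution of the quotient by a regular sequence is concentrated in one degree. -/
lemma isZero_homology_linearDual_of_isWeaklyRegular {rs : List R} (hrs : IsWeaklyRegular R rs)
    (hI : Ideal.ofList rs ≠ ⊤) {F : Cpx R} (hF : IsStrictlyPerfect F)
    (e : Q.obj F ≅ (DerivedCategory.singleFunctor (ModuleCat.{u} R) 0).obj
      (ModuleCat.of R (R ⧸ Ideal.ofList rs)))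
    (hpd : HasProjectiveDimensionLE (ModuleCat.of R (R ⧸ Ideal.ofList rs)) rs.length)
    {l : ℤ} (hl : l ≠ rs.length) : IsZero ((linearDual R F).homology l) := by
  have := hF.isKProjective
  refine isZero_homology_linearDual ((extVanish_congr_left e).2 ?_)
  obtain hl' | ⟨n, rfl⟩ : l < 0 ∨ ∃ n : ℕ, l = n := by
    by_cases h : l < 0
    · exact .inl h
    · exact .inr ⟨l.toNat, by lia⟩
  · exact modExtVanish_of_isGE (a := 0) _ inferInstance hl'
  · refine (modExtVanish_single_iff _ _ _).2 ?_
    -- Below the length the regular sequence inside I forces vanishing; above it the projective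
    -- dimension does.
    by_cases hn : n < rs.length
    · refine ModuleCat.subsingleton_ext_of_exists_isRegular (Ideal.ofList rs) _ ?_
        (ModuleCat.of R R) ?_ rs (fun r hr ↦ Ideal.subset_span hr) ⟨hrs, ?_⟩ n hn
      · intro q hq
        have := Module.mem_support_iff_of_finite.1 hq
        rwa [Ideal.annihilator_quotient] at this
      · rw [smul_eq_mul, Ideal.mul_top]
        exact hI.lt_top
      · rw [smul_eq_mul, Ideal.mul_top]
        exact hI.symm
    · exact HasProjectiveDimensionLT.subsingleton _ (rs.length + 1) n (by lia) _

/-- The test module is T = Ext^d(R/I, R), for I generated by a weakly regular sequence of length d =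
height(p) in p. Duality shifts nonvanishing for R/I in degree j to Ext^(j+d)(T, M) ≠ 0. -/
lemma IsCohenMacaulay.iSup_height_sub_width_le_rid (hR : IsCohenMacaulay R) {M : Cpx R}
    (hM : IsCohBounded M) :
    (⨆ p : PrimeSpectrum R, height p - width p.asIdeal M) ≤ rid M := by
  refine iSup_le fun p ↦ ?_
  obtain ⟨d, hd, hd'⟩ := height_eq p
  rw [sub_width, hd', add_cohSup_le_iff (EReal.coe_ne_bot _) (EReal.coe_ne_top _)]
  intro n hn
  obtain ⟨_, b, hb⟩ := hM
  rw [isZero_derivedTensor_homology_iff _ _ (add_neg_cancel n)] at hn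
  obtain ⟨rs, hl, hrsp, hrs⟩ := hR.exists_isWeaklyRegular (p := p.asIdeal) d hd.ge
  have hIp : Ideal.ofList rs ≤ p.asIdeal := Ideal.span_le.2 hrsp
  obtain ⟨j, hj, hj'⟩ := exists_not_modExtVanish_quotient
    (isGE_charDual fun n hn ↦ (hb n hn).2) hIp hn
  have hpd : HasProjectiveDimensionLE (ModuleCat.of R (R ⧸ Ideal.ofList rs)) rs.length := by
    have h0 : HasProjectiveDimensionLE (ModuleCat.of R R) 0 :=
      projective_iff_hasProjectiveDimensionLT_one.1
        (ModuleCat.projective_of_categoryTheory_projective _)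
    have := projectiveDimension_quotient_of_isWeaklyRegular rs _ 0 h0 hrs
    rw [zero_add] at this
    exact hasProjectiveDimensionLT_of_iso (LinearEquiv.toModuleIso
      (Submodule.quotEquivOfEq (Ideal.ofList rs • (⊤ : Ideal R)) (Ideal.ofList rs)
        (by rw [smul_eq_mul, Ideal.mul_top]))) (rs.length + 1)
  obtain ⟨F, hF, ⟨e⟩⟩ := exists_strictlyPerfect_iso rs.length
    (ModuleCat.of R (R ⧸ Ideal.ofList rs))
  have hG := hF.linearDual
  obtain ⟨T, hT, ⟨eT⟩⟩ := hG.exists_finProj_iso fun l hl ↦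
    isZero_homology_linearDual_of_isWeaklyRegular hrs (fun h ↦ p.2.ne_top (top_le_iff.1 (h ▸ hIp)))
      hF e hpd hl
  have h1 : ¬ ModExtVanish T (Q.obj M) (j + rs.length) := fun h ↦ hj' <|
    (extVanish_congr_left (Q.mapIso (bidualIso hF).symm ≪≫ e)).1 <|
      (extVanish_linearDual_iff hG (add_neg_cancel j)).2 <|
        (extVanish_congr_left eT).2 ((extVanish_singleFunctor_iff rfl).2 h)
  refine le_trans ?_ (mem_rid hT h1)
  rw [← EReal.coe_add, EReal.coe_le_coe_iff, hl]
  have : (n : ℝ) ≤ j := by exact_mod_cast hj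
  push_cast
  linarith

/-- Ext^i(T, M) is H^i(F^* ⊗ M). If it is nonzero, some R/q with q in the support of H^l(F^*) has
H^(i-l)(R/q ⊗ᴸ M) ≠ 0, and height(q) ≥ l makes up for the shift by l. -/
lemma rid_le_iSup_height_sub_width (M : Cpx R) :
    rid M ≤ ⨆ p : PrimeSpectrum R, height p - width p.asIdeal M := by
  refine iSup₂_le fun i ⟨T, hT, hi⟩ ↦ ?_
  rw [isZero_derivedHom_homology_iff] at hi
  have hT' := hT
  obtain ⟨hTf, N, hN⟩ := hT'
  obtain ⟨F, hF, ⟨e⟩⟩ := exists_strictlyPerfect_iso N T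
  have hG := hF.linearDual
  obtain ⟨l, q, hq, hql⟩ : ∃ (l : ℤ) (q : PrimeSpectrum R),
      q ∈ Module.support R ((linearDual R F).homology l) ∧
      ¬ ModExtVanish (ModuleCat.of R (R ⧸ q.asIdeal)) (Q.obj (charDual M)) (-i + l) := by
    by_contra! h
    refine hi ((extVanish_congr_left e).1
      ((extVanish_linearDual_iff hF (add_neg_cancel i)).1 ?_))
    obtain ⟨a, b, hab⟩ := hG.bounded
    have eH (l : ℤ) : (homologyFunctor (ModuleCat.{u} R) l).obj (Q.obj (linearDual R F)) ≅
        (linearDual R F).homology l := (homologyFunctorFactors (ModuleCat.{u} R) l).app _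
    have hz (l : ℤ) (hl : ¬ (a ≤ l ∧ l ≤ b)) :
        IsZero ((homologyFunctor (ModuleCat.{u} R) l).obj (Q.obj (linearDual R F))) := by
      refine IsZero.of_iso ?_ (eH l)
      have := hab l hl
      exact ((HomologicalComplex.exactAt_iff_isZero_homology _ _).1 (ShortComplex.exact_of_isZero_X₂ _
        (ModuleCat.isZero_of_subsingleton ((linearDual R F).X l))))
    refine extVanish_of_homology (b + 1 - a).toNat _ b
      ((DerivedCategory.isLE_iff _ _).2 fun l hl ↦ hz l (by lia))
      ((DerivedCategory.isGE_iff _ _).2 fun l hl ↦ hz l (by lia)) fun l ↦ ?_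
    have := hG.finite l
    have := finite_homology (G := linearDual R F) (i := l)
    exact ModExtVanish.congr (modExtVanish_of_support _ (h l)) (eH l).symm
  obtain ⟨d, hd, hd'⟩ := height_eq q
  have hld := le_height_of_mem_support_homology_linearDual hT hF e hq hd
  rw [← isZero_derivedTensor_homology_iff _ M (n := i - l) (by ring)] at hql
  refine le_iSup_of_le q ?_
  rw [sub_width, hd']
  refine le_trans ?_ (add_le_add le_rfl (le_cohSup hql))
  rw [← EReal.coe_add, EReal.coe_le_coe_iff]
  have : (l : ℝ) ≤ d := by exact_mod_cast hld
  push_cast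
  linarith

lemma IsCohenMacaulay.chouinard_eq (hR : IsCohenMacaulay R) (M : Cpx R) :
    chouinard M = ⨆ p : PrimeSpectrum R, height p - width p.asIdeal M := by
  rw [← iSup_height_sub_localWidth, chouinard]
  exact iSup_congr fun p ↦ by rw [hR p]

lemma IsCohenMacaulay.widthClass_height (hR : IsCohenMacaulay R) :
    widthClass (height (R := R)) = {M : ModuleCat.{u} R | chouinard (single M) ≤ 0} := by
  ext M
  simp only [widthClass, Set.mem_ofPred_eq, hR.chouinard_eq, iSup_le_iff, EReal.sub_nonpos]

end RestrictedInjectiveDimension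

end RestrictedInjDim

end


theorem mainTheorem6 {R : Type u} [CommRing R] [IsNoetherianRing R]
    (hdim : ringKrullDim R < ⊤) :
    (∀ M : CochainComplex (ModuleCat.{u} R) ℤ, RestrictedInjDim.IsCohBounded M →
      (⨆ p : PrimeSpectrum R, RestrictedInjDim.height p -
          RestrictedInjDim.localWidth (Localization.AtPrime p.asIdeal)
            (RestrictedInjDim.localize p M)) =
        ⨆ p : PrimeSpectrum R,
          RestrictedInjDim.height p - RestrictedInjDim.width p.asIdeal M) ∧
    (RestrictedInjDim.IsCohenMacaulay R →
      (∀ M : CochainComplex (ModuleCat.{u} R) ℤ, RestrictedInjDim.IsCohBounded M →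
        RestrictedInjDim.chouinard M = RestrictedInjDim.rid M) ∧
      RestrictedInjDim.widthClass (RestrictedInjDim.height (R := R)) =
        {M : ModuleCat.{u} R |
          RestrictedInjDim.chouinard (RestrictedInjDim.single M) ≤ 0}) :=
  ⟨fun M _ ↦ RestrictedInjDim.iSup_height_sub_localWidth M, fun hR ↦
    ⟨fun M hM ↦ (hR.chouinard_eq M).trans (le_antisymm (hR.iSup_height_sub_width_le_rid hM)
      (RestrictedInjDim.rid_le_iSup_height_sub_width M)), hR.widthClass_height⟩⟩
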